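/- Let $\mathfrak g$ be a (finite-dimensional) simple real Lie algebra with a Cartan involution $\theta$ and corresponding Cartan decomposition $\mathfrak g=\mathfrak k\oplus\mathfrak p$ such that $\mathfrak z(\mathfrak k)\neq\{0\}$ ($\mathfrak g$ is hermitian), and let $\tau$ be an involutive automorphism of $\mathfrak g$ commuting with $\theta$, with $\mathfrak h=\{X:\tau X=X\}$ and $\mathfrak q=\{X:\tau X=-X\}$. Assume that $(\mathfrak g,\tau)$ is compactly causal, i.e. $\mathfrak z(\mathfrak k)\subseteq\mathfrak q$. Let $Z_0\in i\mathfrak z(\mathfrak k)$ be such that $\operatorname{ad}Z_0$ has spectrum $\{1,0,-1\}$ on $\mathfrak g_{\mathbb C}$, and put $\mathfrak p^+=\{X\in\mathfrak g_{\mathbb C}:[Z_0,X]=X\}$. Let $\mathfrak t\subseteq\mathfrak k$ be a $\tau$-stable Cartan subalgebra of $\mathfrak k$ for which $\mathfrak t\cap\mathfrak q$ is maximal abelian in $\mathfrak k\cap\mathfrak q$, and put $\mathfrak a=i(\mathfrak t\cap\mathfrak q)$. Let $\widehat\Delta$ be the root system of $\mathfrak g_{\mathbb C}$ with respect to $\mathfrak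 t_{\mathbb C}$ and let $\widehat\Delta^+$ be a positive system such that a root $\alpha$ with $\alpha(Z_0)\neq0$ is positive if and only if $\alpha(Z_0)=1$, and such that the non-zero restrictions to $\mathfrak a$ of the elements of $\widehat\Delta^+$ form a positive system in the set of all non-zero restrictions of roots to $\mathfrak a$. Put $\widehat\Delta_k^+=\{\alpha\in\widehat\Delta^+:\alpha(Z_0)=0\}$. For $\lambda\in i\mathfrak t^*$ dominant integral with respect to $\widehat\Delta_k^+$ let $F(\lambda)$ be the irreducible $\mathfrak k_{\mathbb C}$-module of highest weight $\lambda$, let $N(\lambda)=\mathcal U(\mathfrak g_{\mathbb C})\otimes_{\mathcal U(\mathfrak k_{\mathbb C}+\mathfrak p^+)}F(\lambda)$ with $\mathfrak p^+$ acting trivially on $F(\lambda)$, and let $L(\lambda)$ be the quotient of $N(\lambda)$ by its maximal submodule $J(\lambda)$. A $\mathfrak g_{\mathbb C}$-module is called unitary if it has a positive definite hermitian form with $\langle X.v,w\rangle=\langle v,X^*.w\rangle$ for all $X\in\mathfrak g_{\mathbb C}$, where $X^*=-\overline X$ and the bar is conjugation with respect to $\mathfrak g$. It is called spherical if there is a non-zero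 antilinear functional $\nu$ on it with $\nu(X.v)=0$ for all $X\in\mathfrak h$ and all $v$. **Lemma V.13.** Let $\lambda,\mu\in i\mathfrak t^*$ be dominant integral with respect to $\widehat\Delta_k^+$. If $L(\lambda)$ and $L(\mu)$ are unitary and spherical, then $\lambda+\mu$ is dominant integral with respect to $\widehat\Delta_k^+$, and $L(\lambda+\mu)$ is unitary and spherical. Moreover, $L(\lambda)$ and $L(\mu)$ have highest weight vectors (non-zero vectors of weight $\lambda$, respectively $\mu$, annihilated by all positive root vectors), and for all highest weight vectors $v_\lambda\in L(\lambda)$ and $v_\mu\in L(\mu)$ the module $L(\lambda+\mu)$ is isomorphic to the $\mathfrak g_{\mathbb C}$-submodule of $L(\lambda)\otimes L(\mu)$ generated by $v_\lambda\otimes v_\mu$. For all non-zero $\mathfrak h$-invariant antilinear functionals $\nu_\lambda$ on $L(\lambda)$ and $\nu_\mu$ on $L(\mu)$, the restriction of $\nu_\lambda\otimes\nu_\mu$ to this submodule is a non-zero $\mathfrak h$-invariant antilinear functional. -/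

import Mathlib

open scoped TensorProduct

noncomputable section

universe u

/-! ### General algebra -/

/-- The sum of all proper submodules.  For a highest weight module, and for a generalized Verma
module, this is the unique maximal submodule. -/
def sumOfProperSubmodules (R M : Type*) [Ring R] [AddCommGroup M] [Module R M] :
    Submodule R M :=
  sSup {S | S ≠ ⊤}

/-- `P` is a positive system in the set `Φ` of linear functionals on the real vector space `E`:
it consists of those elements of `Φ` that are positive at a point where no element of `Φ`
vanishes. -/
def IsPositiveSystem {E : Type*} [AddCommGroup E] [Module ℝ E]
    (Φ P : Set (Module.Dual ℝ E)) : Prop :=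
  ∃ x : E, (∀ α ∈ Φ, α x ≠ 0) ∧ P = {α ∈ Φ | 0 < α x}

/-- The tensor product of two antilinear functionals,
`(ν₁ ⊗ ν₂) (v ⊗ w) = ν₁ v * ν₂ w`, again an antilinear functional. -/
def antilinearTensor {V W : Type*} [AddCommGroup V] [Module ℂ V] [AddCommGroup W] [Module ℂ W]
    (ν₁ : V →ₛₗ[starRingEnd ℂ] ℂ) (ν₂ : W →ₛₗ[starRingEnd ℂ] ℂ) :
    V ⊗[ℂ] W →ₛₗ[starRingEnd ℂ] ℂ :=
  TensorProduct.lift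
    (LinearMap.mk₂'ₛₗ (starRingEnd ℂ) (starRingEnd ℂ) (fun v w => ν₁ v * ν₂ w)
      (fun v v' w => by simp [add_mul]) (fun c v w => by simp [mul_assoc])
      (fun v w w' => by simp [mul_add]) (fun c v w => by simp [mul_left_comm]))

theorem antilinearTensor_tmul {V W : Type*} [AddCommGroup V] [Module ℂ V] [AddCommGroup W]
    [Module ℂ W] (ν₁ : V →ₛₗ[starRingEnd ℂ] ℂ) (ν₂ : W →ₛₗ[starRingEnd ℂ] ℂ) (v : V) (w : W) :
    antilinearTensor ν₁ ν₂ (v ⊗ₜ[ℂ] w) = ν₁ v * ν₂ w := rfl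

/-! ### The complexification of a real Lie algebra and unitarizable modules -/

section Complexification

variable (𝔤 : Type u) [LieRing 𝔤] [LieAlgebra ℝ 𝔤]

/-- The complexification `𝔤_ℂ = ℂ ⊗ 𝔤`. -/
def Cplx : Type u := ℂ ⊗[ℝ] 𝔤

instance : LieRing (Cplx 𝔤) := inferInstanceAs (LieRing (ℂ ⊗[ℝ] 𝔤))

instance : LieAlgebra ℂ (Cplx 𝔤) := inferInstanceAs (LieAlgebra ℂ (ℂ ⊗[ℝ] 𝔤))

variable {𝔤}

/-- The element `z ⊗ X` of `𝔤_ℂ`. -/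
def Cplx.tmul (z : ℂ) (X : 𝔤) : Cplx 𝔤 := (z ⊗ₜ[ℝ] X : ℂ ⊗[ℝ] 𝔤)

/-- The element `X` of `𝔤`, as an element of `𝔤_ℂ`. -/
def toCplx (X : 𝔤) : Cplx 𝔤 := Cplx.tmul 1 X

/-- The element `i X` of `𝔤_ℂ`, for `X` in `𝔤`. -/
def iMul (X : 𝔤) : Cplx 𝔤 := Cplx.tmul Complex.I X

theorem Cplx.lie_tmul_tmul (z w : ℂ) (X Y : 𝔤) :
    ⁅Cplx.tmul z X, Cplx.tmul w Y⁆ = Cplx.tmul (z * w) ⁅X, Y⁆ := rfl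

theorem Cplx.smul_tmul (c z : ℂ) (X : 𝔤) :
    c • Cplx.tmul z X = Cplx.tmul (c * z) X := rfl

variable (𝔤) in
/-- The conjugation of `𝔤_ℂ` with respect to the real form `𝔤`. -/
def cplxConj : Cplx 𝔤 →ₗ⋆[ℂ] Cplx 𝔤 where
  toFun x := LinearMap.rTensor 𝔤 Complex.conjAe.toLinearMap (x : ℂ ⊗[ℝ] 𝔤)
  map_add' x y := map_add (LinearMap.rTensor 𝔤 Complex.conjAe.toLinearMap) x y
  map_smul' c x := by
    have key : ∀ y : ℂ ⊗[ℝ] 𝔤, LinearMap.rTensor 𝔤 Complex.conjAe.toLinearMap (c • y) =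
        starRingEnd ℂ c • LinearMap.rTensor 𝔤 Complex.conjAe.toLinearMap y := by
      intro y
      induction y using TensorProduct.induction_on with
      | zero => simp
      | tmul z X => simp [TensorProduct.smul_tmul']
      | add a b ha hb => rw [smul_add, map_add, ha, hb, map_add, smul_add]
    exact key x

theorem cplxConj_tmul (z : ℂ) (X : 𝔤) :
    cplxConj 𝔤 (Cplx.tmul z X) = Cplx.tmul (starRingEnd ℂ z) X := rfl

/-- The antilinear involution `X ↦ X^* = - conj X` of `𝔤_ℂ`. -/
def cplxStar (X : Cplx 𝔤) : Cplx 𝔤 := - cplxConj 𝔤 X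

/-- A `𝔤_ℂ`-module is unitarizable if it carries a positive definite contravariant hermitian
form.  The form is antilinear in the first and linear in the second argument. -/
def IsUnitarizable (V : Type*) [AddCommGroup V] [Module ℂ V] [LieRingModule (Cplx 𝔤) V] : Prop :=
  ∃ B : V →ₗ⋆[ℂ] V →ₗ[ℂ] ℂ,
    (∀ v w, B w v = starRingEnd ℂ (B v w)) ∧
    (∀ v, v ≠ 0 → 0 < (B v v).re) ∧
    (∀ (X : Cplx 𝔤) (v w : V), B ⁅X, v⁆ w = B v ⁅cplxStar X, w⁆)

end Complexification

/-! ### Hermitian symmetric Lie algebras -/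

/-- A hermitian symmetric Lie algebra: a real Lie algebra (assumed simple in
the theorem) with a Cartan involution `θ` such that the fixed algebra `𝔨` of `θ` has non-zero
center, and with an involutive automorphism `τ` commuting with `θ`. -/
structure HermitianSymmetric (𝔤 : Type u) [LieRing 𝔤] [LieAlgebra ℝ 𝔤] where
  /-- the Cartan involution -/
  θ : 𝔤 ≃ₗ⁅ℝ⁆ 𝔤
  θ_invol : ∀ X, θ (θ X) = X
  θ_cartan : ∀ X, X ≠ 0 → 0 < - killingForm ℝ 𝔤 X (θ X)
  hermitian : ∃ Z, Z ≠ 0 ∧ θ Z = Z ∧ ∀ X, θ X = X → ⁅Z, X⁆ = 0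
  /-- the involution defining the symmetric structure -/
  τ : 𝔤 ≃ₗ⁅ℝ⁆ 𝔤
  τ_invol : ∀ X, τ (τ X) = X
  τ_θ : ∀ X, τ (θ X) = θ (τ X)

namespace HermitianSymmetric

variable {𝔤 : Type u} [LieRing 𝔤] [LieAlgebra ℝ 𝔤] (S : HermitianSymmetric 𝔤)

/-- `𝔨`, the fixed algebra of the Cartan involution. -/
def k : LieSubalgebra ℝ 𝔤 where
  carrier := {X | S.θ X = X}
  zero_mem' := map_zero _
  add_mem' := fun {a b} (ha : S.θ a = a) (hb : S.θ b = b) => by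
    change S.θ (a + b) = a + b
    rw [map_add, ha, hb]
  smul_mem' := fun c x (hx : S.θ x = x) => by
    change S.θ (c • x) = c • x
    rw [map_smul, hx]
  lie_mem' := fun {a b} (ha : S.θ a = a) (hb : S.θ b = b) => by
    change S.θ ⁅a, b⁆ = ⁅a, b⁆
    rw [LieEquiv.map_lie, ha, hb]

/-- `Z` lies in the center of `𝔨`. -/
def MemCenterK (Z : 𝔤) : Prop := Z ∈ S.k ∧ ∀ X ∈ S.k, ⁅Z, X⁆ = 0

/-- `𝔥`, the fixed space of `τ`. -/
def h : Submodule ℝ 𝔤 := LinearMap.eqLocus (S.τ : 𝔤 →ₗ[ℝ] 𝔤) LinearMap.id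

/-- `𝔮`, the `(-1)`-eigenspace of `τ`. -/
def q : Submodule ℝ 𝔤 := LinearMap.eqLocus (S.τ : 𝔤 →ₗ[ℝ] 𝔤) (-LinearMap.id)

/-- The hermitian symmetric Lie algebra is compactly causal: the center of `𝔨` lies in `𝔮`. -/
def IsCompactlyCausal : Prop := ∀ Z, S.MemCenterK Z → Z ∈ S.q

/-- `𝔨_ℂ`, the complex span of `𝔨` in `𝔤_ℂ`. -/
def kC : LieSubalgebra ℂ (Cplx 𝔤) where
  toSubmodule := Submodule.span ℂ (toCplx '' (S.k : Set 𝔤))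
  lie_mem' := fun {x y} hx hy => by
    change x ∈ Submodule.span ℂ (toCplx '' (S.k : Set 𝔤)) at hx
    change y ∈ Submodule.span ℂ (toCplx '' (S.k : Set 𝔤)) at hy
    change ⁅x, y⁆ ∈ Submodule.span ℂ (toCplx '' (S.k : Set 𝔤))
    induction hx using Submodule.span_induction with
    | mem x hx =>
      obtain ⟨X, hX, rfl⟩ := hx
      induction hy using Submodule.span_induction with
      | mem y hy =>
        obtain ⟨Y, hY, rfl⟩ := hy
        refine Submodule.subset_span ⟨⁅X, Y⁆, S.k.lie_mem hX hY, ?_⟩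
        rw [toCplx, toCplx, toCplx, Cplx.lie_tmul_tmul, one_mul]
      | zero => rw [lie_zero]; exact Submodule.zero_mem _
      | add a b _ _ ha hb => rw [lie_add]; exact Submodule.add_mem _ ha hb
      | smul c a _ ha => rw [lie_smul]; exact Submodule.smul_mem _ c ha
    | zero => rw [zero_lie]; exact Submodule.zero_mem _
    | add a b _ _ ha hb => rw [add_lie]; exact Submodule.add_mem _ ha hb
    | smul c a _ ha => rw [smul_lie]; exact Submodule.smul_mem _ c ha

/-- An antilinear functional on a `𝔤_ℂ`-module that is non-zero and annihilated by `𝔥`. -/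
def IsSphericalFunctional {V : Type*} [AddCommGroup V] [Module ℂ V] [LieRingModule (Cplx 𝔤) V]
    (ν : V →ₛₗ[starRingEnd ℂ] ℂ) : Prop :=
  ν ≠ 0 ∧ ∀ X ∈ S.h, ∀ v : V, ν ⁅toCplx X, v⁆ = 0

/-- A `𝔤_ℂ`-module is spherical if it has a non-zero `𝔥`-invariant antilinear functional. -/
def IsSpherical (V : Type*) [AddCommGroup V] [Module ℂ V] [LieRingModule (Cplx 𝔤) V] : Prop :=
  ∃ ν : V →ₛₗ[starRingEnd ℂ] ℂ, S.IsSphericalFunctional ν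

/-- The weight space in `𝔤_ℂ` of the functional `α` in `i 𝔱^*`.

Here and below an element `α` of `i 𝔱^*` (a complex linear functional on `𝔱_ℂ` that is real on
`i 𝔱`) is recorded by its restriction to the real form `i 𝔱`, transported to `𝔱` by
`X ↦ i X`; so for `X` in `𝔱` the real number `α X` below is the value of the functional
at `i X`. -/
def rootSpace (t : LieSubalgebra ℝ 𝔤)
    (α : Module.Dual ℝ t) : Set (Cplx 𝔤) :=
  {x | ∀ X : t, ⁅iMul (X : 𝔤), x⁆ = (α X : ℂ) • x}

/-- The set of roots of `𝔤_ℂ` with respect to `𝔱_ℂ`. -/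
def roots (t : LieSubalgebra ℝ 𝔤) : Set (Module.Dual ℝ t) :=
  {α | α ≠ 0 ∧ ∃ x ∈ rootSpace t α, x ≠ 0}

/-- The real space `𝔱 ∩ 𝔮`; then `𝔞 = i (𝔱 ∩ 𝔮)`. -/
def tq (t : LieSubalgebra ℝ 𝔤) : Submodule ℝ t := S.q.comap t.toSubmodule.subtype

/-- The set of non-zero restrictions to `𝔞 = i (𝔱 ∩ 𝔮)` of a set of functionals on `i 𝔱`. -/
def restrictedSet (t : LieSubalgebra ℝ 𝔤) (Φ : Set (Module.Dual ℝ t)) :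
    Set (Module.Dual ℝ (S.tq t)) :=
  (fun α : Module.Dual ℝ t => α.comp (S.tq t).subtype) '' Φ \ {0}

/-- The choices on which the parametrization of highest weight modules depends: the normalized
central element `Z₀`, the Cartan subalgebra `𝔱` of `𝔨` and the positive system of roots, adapted
to the symmetric structure. -/
structure CartanData where
  /-- The element of the center of `𝔨` with `Z₀ = i Z`. -/
  Z : 𝔤
  Z_center : S.MemCenterK Z
  Z_spec : spectrum ℂ (LieAlgebra.ad ℂ (Cplx 𝔤) (iMul Z)) = {1, 0, -1}
  /-- The Cartan subalgebra of `𝔨`, i.e. a maximal abelian subalgebra. -/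
  t : LieSubalgebra ℝ 𝔤
  t_le : t ≤ S.k
  t_abelian : ∀ X ∈ t, ∀ Y ∈ t, ⁅X, Y⁆ = 0
  t_maximal : ∀ X ∈ S.k, (∀ Y ∈ t, ⁅X, Y⁆ = 0) → X ∈ t
  /-- `𝔱 = (𝔱 ∩ 𝔥) ⊕ (𝔱 ∩ 𝔮)` -/
  t_stable : ∀ X ∈ t, S.τ X ∈ t
  /-- `𝔱 ∩ 𝔮` is maximal abelian in `𝔮 ∩ 𝔨` -/
  tq_maximal : ∀ X ∈ S.q, X ∈ S.k → (∀ Y ∈ t, Y ∈ S.q → ⁅X, Y⁆ = 0) → X ∈ t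
  /-- The set of positive roots. -/
  pos : Set (Module.Dual ℝ t)
  pos_system : IsPositiveSystem (roots t) pos
  /-- The positive non-compact roots are the roots with value `1` at `Z₀`. -/
  pos_noncompact : ∀ α ∈ roots t,
    α ⟨Z, t_maximal Z Z_center.1 fun Y hY => Z_center.2 Y (t_le hY)⟩ ≠ 0 →
      (α ∈ pos ↔ α ⟨Z, t_maximal Z Z_center.1 fun Y hY => Z_center.2 Y (t_le hY)⟩ = 1)
  /-- The non-zero restrictions of the positive roots to `𝔞` form a positive system of the
  restricted root system. -/
  pos_restricted : IsPositiveSystem (S.restrictedSet t (roots t)) (S.restrictedSet t pos)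

namespace CartanData

variable {S} (C : S.CartanData)

/-- The central element `Z₀`. -/
def Z₀ : Cplx 𝔤 := iMul C.Z

/-- The element `Z` (with `Z₀ = i Z`) as an element of `𝔱`. -/
def Zt : C.t :=
  ⟨C.Z, C.t_maximal C.Z C.Z_center.1 fun Y hY => C.Z_center.2 Y (C.t_le hY)⟩

/-- The space `i 𝔱^*`, with the convention explained above. -/
abbrev Weight : Type u := Module.Dual ℝ C.t

/-- The compact positive roots: those which vanish at `Z₀`. -/
def compactPos : Set C.Weight := {α ∈ C.pos | α C.Zt = 0}

/-- `iMul X` is the coroot of `α`: it lies in `[𝔤^α, 𝔤^{-α}]` and `α` takes the value `2`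
there. -/
def IsCoroot (α : C.Weight) (X : C.t) : Prop :=
  (∃ e ∈ rootSpace C.t α, ∃ f ∈ rootSpace C.t (-α), ⁅e, f⁆ = iMul (X : 𝔤)) ∧ α X = 2

/-- `lam` is dominant integral with respect to the compact positive roots. -/
def IsDominantIntegral (lam : C.Weight) : Prop :=
  ∀ α ∈ C.compactPos, ∀ X : C.t, C.IsCoroot α X → ∃ n : ℕ, lam X = n

/-- `v` is a highest weight vector of weight `lam`: non-zero, of weight `lam`, and
annihilated by all positive root vectors. -/
def IsHighestWeightVector {V : Type*} [AddCommGroup V] [Module ℂ V] [LieRingModule (Cplx 𝔤) V]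
    (lam : C.Weight) (v : V) : Prop :=
  v ≠ 0 ∧ (∀ X : C.t, ⁅iMul (X : 𝔤), v⁆ = (lam X : ℂ) • v) ∧
    ∀ α ∈ C.pos, ∀ x ∈ rootSpace C.t α, ⁅x, v⁆ = 0

/-! #### The module `F(λ)` of `𝔨_ℂ` -/

/-- The left ideal of `U(𝔨_ℂ)` generated by the compact positive root spaces and by the elements
`i X - λ(i X)` for `X` in `𝔱`. -/
def vermaIdeal (lam : C.Weight) :
    Submodule (UniversalEnvelopingAlgebra ℂ S.kC) (UniversalEnvelopingAlgebra ℂ S.kC) :=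
  Submodule.span _
    ({u | ∃ α ∈ C.compactPos, ∃ x : S.kC, (x : Cplx 𝔤) ∈ rootSpace C.t α ∧
        u = UniversalEnvelopingAlgebra.ι ℂ x} ∪
     {u | ∃ (X : C.t) (x : S.kC), (x : Cplx 𝔤) = iMul (X : 𝔤) ∧
        u = UniversalEnvelopingAlgebra.ι ℂ x - algebraMap ℂ _ (lam X : ℂ)})

/-- The Verma module of `𝔨_ℂ` of highest weight `λ`. -/
def VermaK (lam : C.Weight) : Type u :=
  UniversalEnvelopingAlgebra ℂ S.kC ⧸ C.vermaIdeal lam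

instance (lam : C.Weight) : AddCommGroup (C.VermaK lam) :=
  inferInstanceAs (AddCommGroup (UniversalEnvelopingAlgebra ℂ S.kC ⧸ C.vermaIdeal lam))

instance (lam : C.Weight) : Module (UniversalEnvelopingAlgebra ℂ S.kC) (C.VermaK lam) :=
  inferInstanceAs (Module (UniversalEnvelopingAlgebra ℂ S.kC) (UniversalEnvelopingAlgebra ℂ S.kC ⧸ C.vermaIdeal lam))

instance (lam : C.Weight) : Module ℂ (C.VermaK lam) :=
  inferInstanceAs (Module ℂ (UniversalEnvelopingAlgebra ℂ S.kC ⧸ C.vermaIdeal lam))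

instance (lam : C.Weight) : IsScalarTower ℂ (UniversalEnvelopingAlgebra ℂ S.kC) (C.VermaK lam) :=
  inferInstanceAs (IsScalarTower ℂ (UniversalEnvelopingAlgebra ℂ S.kC) (UniversalEnvelopingAlgebra ℂ S.kC ⧸ C.vermaIdeal lam))

/-- The irreducible highest weight module `F(λ)` of `𝔨_ℂ`: the simple quotient of the Verma module.
It is finite-dimensional when `λ` is dominant integral. -/
def F (lam : C.Weight) : Type u :=
  C.VermaK lam ⧸ sumOfProperSubmodules (UniversalEnvelopingAlgebra ℂ S.kC) (C.VermaK lam)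

instance (lam : C.Weight) : AddCommGroup (C.F lam) :=
  inferInstanceAs (AddCommGroup (C.VermaK lam ⧸
    sumOfProperSubmodules (UniversalEnvelopingAlgebra ℂ S.kC) (C.VermaK lam)))

instance (lam : C.Weight) : Module (UniversalEnvelopingAlgebra ℂ S.kC) (C.F lam) :=
  inferInstanceAs (Module (UniversalEnvelopingAlgebra ℂ S.kC) (C.VermaK lam ⧸
    sumOfProperSubmodules (UniversalEnvelopingAlgebra ℂ S.kC) (C.VermaK lam)))

instance (lam : C.Weight) : Module ℂ (C.F lam) :=
  inferInstanceAs (Module ℂ (C.VermaK lam ⧸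
    sumOfProperSubmodules (UniversalEnvelopingAlgebra ℂ S.kC) (C.VermaK lam)))

instance (lam : C.Weight) : IsScalarTower ℂ (UniversalEnvelopingAlgebra ℂ S.kC) (C.F lam) :=
  inferInstanceAs (IsScalarTower ℂ (UniversalEnvelopingAlgebra ℂ S.kC) (C.VermaK lam ⧸
    sumOfProperSubmodules (UniversalEnvelopingAlgebra ℂ S.kC) (C.VermaK lam)))

/-! #### The generalized Verma module `N(λ)` and its simple quotient `L(λ)` -/

/-- The relations defining the tensor product over `U(𝔨_ℂ + 𝔭⁺)`, where
`𝔭⁺ = {x : [Z₀, x] = x}` acts trivially on `F(λ)`. -/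
def inducedRel (lam : C.Weight) :
    Submodule (UniversalEnvelopingAlgebra ℂ (Cplx 𝔤))
      (UniversalEnvelopingAlgebra ℂ (Cplx 𝔤) ⊗[ℂ] C.F lam) :=
  Submodule.span _
    ({m | ∃ (u : UniversalEnvelopingAlgebra ℂ (Cplx 𝔤)) (x : S.kC) (f : C.F lam),
        m = (u * UniversalEnvelopingAlgebra.ι ℂ (x : Cplx 𝔤)) ⊗ₜ[ℂ] f -
          u ⊗ₜ[ℂ] (UniversalEnvelopingAlgebra.ι ℂ x • f)} ∪
     {m | ∃ (u : UniversalEnvelopingAlgebra ℂ (Cplx 𝔤)) (x : Cplx 𝔤) (f : C.F lam),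
        ⁅C.Z₀, x⁆ = x ∧ m = (u * UniversalEnvelopingAlgebra.ι ℂ x) ⊗ₜ[ℂ] f})

/-- The generalized Verma module `N(λ) = U(𝔤_ℂ) ⊗_{U(𝔨_ℂ + 𝔭⁺)} F(λ)`. -/
def N (lam : C.Weight) : Type u :=
  (UniversalEnvelopingAlgebra ℂ (Cplx 𝔤) ⊗[ℂ] C.F lam) ⧸ C.inducedRel lam

instance (lam : C.Weight) : AddCommGroup (C.N lam) :=
  inferInstanceAs (AddCommGroup ((UniversalEnvelopingAlgebra ℂ (Cplx 𝔤) ⊗[ℂ] C.F lam) ⧸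
    C.inducedRel lam))

instance (lam : C.Weight) : Module (UniversalEnvelopingAlgebra ℂ (Cplx 𝔤)) (C.N lam) :=
  inferInstanceAs (Module (UniversalEnvelopingAlgebra ℂ (Cplx 𝔤)) ((UniversalEnvelopingAlgebra ℂ (Cplx 𝔤) ⊗[ℂ] C.F lam) ⧸
    C.inducedRel lam))

instance (lam : C.Weight) : Module ℂ (C.N lam) :=
  inferInstanceAs (Module ℂ ((UniversalEnvelopingAlgebra ℂ (Cplx 𝔤) ⊗[ℂ] C.F lam) ⧸
    C.inducedRel lam))

instance (lam : C.Weight) : IsScalarTower ℂ (UniversalEnvelopingAlgebra ℂ (Cplx 𝔤)) (C.N lam) :=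
  inferInstanceAs (IsScalarTower ℂ (UniversalEnvelopingAlgebra ℂ (Cplx 𝔤)) ((UniversalEnvelopingAlgebra ℂ (Cplx 𝔤) ⊗[ℂ] C.F lam) ⧸
    C.inducedRel lam))

/-- The maximal submodule `J(λ)` of `N(λ)`. -/
abbrev J (lam : C.Weight) : Submodule (UniversalEnvelopingAlgebra ℂ (Cplx 𝔤)) (C.N lam) :=
  sumOfProperSubmodules (UniversalEnvelopingAlgebra ℂ (Cplx 𝔤)) (C.N lam)

/-- The irreducible highest weight module `L(λ) = N(λ) / J(λ)`. -/
def L (lam : C.Weight) : Type u := C.N lam ⧸ C.J lam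

instance (lam : C.Weight) : AddCommGroup (C.L lam) :=
  inferInstanceAs (AddCommGroup (C.N lam ⧸ C.J lam))

instance (lam : C.Weight) : Module (UniversalEnvelopingAlgebra ℂ (Cplx 𝔤)) (C.L lam) :=
  inferInstanceAs (Module (UniversalEnvelopingAlgebra ℂ (Cplx 𝔤)) (C.N lam ⧸ C.J lam))

instance (lam : C.Weight) : Module ℂ (C.L lam) :=
  inferInstanceAs (Module ℂ (C.N lam ⧸ C.J lam))

instance (lam : C.Weight) :
    IsScalarTower ℂ (UniversalEnvelopingAlgebra ℂ (Cplx 𝔤)) (C.L lam) :=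
  inferInstanceAs
    (IsScalarTower ℂ (UniversalEnvelopingAlgebra ℂ (Cplx 𝔤)) (C.N lam ⧸ C.J lam))

attribute [local instance] LieRing.ofAssociativeRing LieAlgebra.ofAssociativeAlgebra in
/-- `𝔤_ℂ` acts on `L(λ)` through `U(𝔤_ℂ)`. -/
instance (lam : C.Weight) : LieRingModule (Cplx 𝔤) (C.L lam) where
  bracket x v := UniversalEnvelopingAlgebra.ι ℂ x • v
  add_lie x y v := by
    rw [map_add, add_smul]
  lie_add x v w := smul_add _ v w
  leibniz_lie x y v := by
    change UniversalEnvelopingAlgebra.ι ℂ x • UniversalEnvelopingAlgebra.ι ℂ y • v =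
      UniversalEnvelopingAlgebra.ι ℂ ⁅x, y⁆ • v +
        UniversalEnvelopingAlgebra.ι ℂ y • UniversalEnvelopingAlgebra.ι ℂ x • v
    rw [LieHom.map_lie, LieRing.of_associative_ring_bracket, sub_smul, mul_smul, mul_smul,
      sub_add_cancel]

instance (lam : C.Weight) : LieModule ℂ (Cplx 𝔤) (C.L lam) where
  smul_lie c x v := by
    change UniversalEnvelopingAlgebra.ι ℂ (c • x) • v =
      c • (UniversalEnvelopingAlgebra.ι ℂ x • v)
    rw [map_smul, smul_assoc]
  lie_smul c x v := by
    change UniversalEnvelopingAlgebra.ι ℂ x • c • v =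
      c • (UniversalEnvelopingAlgebra.ι ℂ x • v)
    rw [← algebraMap_smul (UniversalEnvelopingAlgebra ℂ (Cplx 𝔤)) c v,
      ← algebraMap_smul (UniversalEnvelopingAlgebra ℂ (Cplx 𝔤)) c
        (UniversalEnvelopingAlgebra.ι ℂ x • v), ← mul_smul, ← mul_smul,
      Algebra.commutes]

/-- The submodule of `L(λ) ⊗ L(μ)` generated by `v ⊗ w`. -/
def tensorSubmodule (lam mu : C.Weight) (v : C.L lam) (w : C.L mu) :
    LieSubmodule ℂ (Cplx 𝔤) (C.L lam ⊗[ℂ] C.L mu) :=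
  LieSubmodule.lieSpan ℂ (Cplx 𝔤) {v ⊗ₜ[ℂ] w}

end CartanData

end HermitianSymmetric

end

/-! The vector v ⊗ w has weight λ + μ and is killed by the positive root vectors, and the submodule
it generates inherits a positive definite contravariant form from L(λ) ⊗ L(μ). Two facts finish the
proof.

First, a unitarizable module M generated by a highest weight vector m of weight λ is L(λ)
(`nonempty_lieEquiv_L`). The Verma module of 𝔨_ℂ maps to M; this map descends to F(λ), induces a map
from N(λ), and descends to L(λ). Both descents use `IsCyclicVector.map_eq_zero_of_ne_top`: a regular
element H of i𝔱 decomposes the source into the line of the generator and lower eigenspaces. A proper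
submodule has no component on that line, so its image is orthogonal to m, by contravariance to the
image of the whole source, and by positivity it is zero. Thus the form does the work, without PBW
and without finite-dimensionality of F(λ).

Second, 𝔤_ℂ = 𝔥_ℂ + 𝔟, where 𝔟 is spanned by 𝔱_ℂ and the positive root vectors (`exists_hC`). Hence
words in 𝔥_ℂ alone already generate L(λ) from a highest weight vector, and an 𝔥-invariant functional
vanishing at that vector is zero. So ν_λ ⊗ ν_μ takes the non-zero value ν_λ(v) ν_μ(w) at v ⊗ w.

The structure theory behind both facts is derived by hand: root vectors span 𝔤_ℂ by simultaneous
diagonalization, and simplicity shows that the centralizer of Z is 𝔨 (`mem_k_of_lie_eq_zero`). -/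

open scoped TensorProduct

noncomputable section

/-! ### Cyclic representations, word filtrations and highest weight vectors -/

section Representations

variable {𝔩 V : Type*} [LieRing 𝔩] [LieAlgebra ℂ 𝔩] [AddCommGroup V] [Module ℂ V]

/-- The vector `v` is contained in no proper subrepresentation of `V`. -/
def IsCyclicVector (ρ : 𝔩 →ₗ[ℂ] Module.End ℂ V) (v : V) : Prop :=
  ∀ Q : Submodule ℂ V, v ∈ Q → (∀ x, ∀ u ∈ Q, ρ x u ∈ Q) → Q = ⊤

/-- The subspaces spanned by the words of bounded length in elements of `n`, applied to `v`. -/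
def wordFiltration (ρ : 𝔩 →ₗ[ℂ] Module.End ℂ V) (n : Submodule ℂ 𝔩) (v : V) :
    ℕ → Submodule ℂ V
  | 0 => Submodule.span ℂ {v}
  | k + 1 => wordFiltration ρ n v k ⊔
      Submodule.span ℂ {w | ∃ y ∈ n, ∃ u ∈ wordFiltration ρ n v k, w = ρ y u}

theorem wordFiltration_mono (ρ : 𝔩 →ₗ[ℂ] Module.End ℂ V) (n : Submodule ℂ 𝔩) (v : V) :
    Monotone (wordFiltration ρ n v) :=
  monotone_nat_of_le_succ fun _ => le_sup_left

theorem wordFiltration_le (ρ : 𝔩 →ₗ[ℂ] Module.End ℂ V) {n : Submodule ℂ 𝔩} {v : V}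
    {P : Submodule ℂ V} (hv : v ∈ P) (hP : ∀ y ∈ n, ∀ u ∈ P, ρ y u ∈ P) (k : ℕ) :
    wordFiltration ρ n v k ≤ P := by
  induction k with
  | zero => simpa [wordFiltration] using hv
  | succ k ih =>
    refine sup_le ih (Submodule.span_le.2 ?_)
    rintro _ ⟨y, hy, u, hu, rfl⟩
    exact hP y hy u (ih hu)

/-- The two claims are proved together. For z stabilizing the line of v, z y u = y z u + [z, y] u,
where [z, y] is an arbitrary element of 𝔩 and is handled by the second claim one level lower. So n
may be any subspace, not only a subalgebra. -/
theorem apply_mem_wordFiltration (ρ : 𝔩 →ₗ[ℂ] Module.End ℂ V)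
    (hρ : ∀ x y u, ρ ⁅x, y⁆ u = ρ x (ρ y u) - ρ y (ρ x u)) {n : Submodule ℂ 𝔩} {v : V}
    (hn : ∀ x, ∃ y ∈ n, ∃ c : ℂ, ρ (x - y) v = c • v) (k : ℕ) :
    (∀ z, (∃ c : ℂ, ρ z v = c • v) →
      ∀ u ∈ wordFiltration ρ n v k, ρ z u ∈ wordFiltration ρ n v k) ∧
    ∀ x, ∀ u ∈ wordFiltration ρ n v k, ρ x u ∈ wordFiltration ρ n v (k + 1) := by
  have step : ∀ k, (∀ z, (∃ c : ℂ, ρ z v = c • v) →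
      ∀ u ∈ wordFiltration ρ n v k, ρ z u ∈ wordFiltration ρ n v k) →
      ∀ x, ∀ u ∈ wordFiltration ρ n v k, ρ x u ∈ wordFiltration ρ n v (k + 1) := by
    intro k hk x u hu
    obtain ⟨y, hy, hc⟩ := hn x
    have h1 : ρ x u = ρ (x - y) u + ρ y u := by
      rw [map_sub, LinearMap.sub_apply, sub_add_cancel]
    rw [h1]
    exact Submodule.add_mem _ (wordFiltration_mono ρ n v k.le_succ (hk _ hc u hu))
      (Submodule.mem_sup_right (Submodule.subset_span ⟨y, hy, u, hu, rfl⟩))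
  have main : ∀ k, ∀ z, (∃ c : ℂ, ρ z v = c • v) →
      ∀ u ∈ wordFiltration ρ n v k, ρ z u ∈ wordFiltration ρ n v k := by
    intro k
    induction k with
    | zero =>
      rintro z ⟨c, hc⟩ u hu
      obtain ⟨a, rfl⟩ := Submodule.mem_span_singleton.1 hu
      rw [map_smul, hc]
      exact Submodule.smul_mem _ _ (Submodule.smul_mem _ _ (Submodule.mem_span_singleton_self v))
    | succ k ih =>
      intro z hz u hu
      have hle : wordFiltration ρ n v (k + 1) ≤ (wordFiltration ρ n v (k + 1)).comap (ρ z) := by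
        refine sup_le (fun u hu => wordFiltration_mono ρ n v k.le_succ (ih z hz u hu))
          (Submodule.span_le.2 ?_)
        rintro _ ⟨y, hy, u, hu, rfl⟩
        have h1 : ρ z (ρ y u) = ρ y (ρ z u) + ρ ⁅z, y⁆ u := by rw [hρ]; abel
        change ρ z (ρ y u) ∈ wordFiltration ρ n v (k + 1)
        rw [h1]
        exact Submodule.add_mem _
          (Submodule.mem_sup_right (Submodule.subset_span ⟨y, hy, _, ih z hz u hu, rfl⟩))
          (step k ih _ u hu)
      exact hle hu
  exact ⟨main k, step k (main k)⟩

/-- If `𝔩` is the sum of `n` and the stabilizer of the line through the cyclic vector `v`, then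
`v` generates the representation already under `n`. -/
theorem IsCyclicVector.eq_top_of_stable {ρ : 𝔩 →ₗ[ℂ] Module.End ℂ V} {v : V}
    (hv : IsCyclicVector ρ v) (hρ : ∀ x y u, ρ ⁅x, y⁆ u = ρ x (ρ y u) - ρ y (ρ x u))
    {n : Submodule ℂ 𝔩} (hn : ∀ x, ∃ y ∈ n, ∃ c : ℂ, ρ (x - y) v = c • v)
    {P : Submodule ℂ V} (hvP : v ∈ P) (hP : ∀ y ∈ n, ∀ u ∈ P, ρ y u ∈ P) : P = ⊤ := by
  have hdir : Directed (· ≤ ·) (wordFiltration ρ n v) := 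
    (wordFiltration_mono ρ n v).directed_le
  -- Each element of 𝔩 raises the filtration degree by at most one, so the union is a
  -- subrepresentation containing v.
  have htop : ⨆ k, wordFiltration ρ n v k = ⊤ := by
    refine hv _ (Submodule.mem_iSup_of_mem 0 (Submodule.mem_span_singleton_self v)) ?_
    intro x u hu
    obtain ⟨k, hk⟩ := (Submodule.mem_iSup_of_directed _ hdir).1 hu
    exact Submodule.mem_iSup_of_mem (k + 1) ((apply_mem_wordFiltration ρ hρ hn k).2 x u hk)
  rw [eq_top_iff, ← htop]
  exact iSup_le (wordFiltration_le ρ hvP hP)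

/-- The span of the eigenvectors with real eigenvalue less than `r`. -/
def lowerEigenspan (T : Module.End ℂ V) (r : ℝ) : Submodule ℂ V :=
  Submodule.span ℂ {u | ∃ s : ℝ, s < r ∧ T u = (s : ℂ) • u}

/-- A product of factors T - s with s < r kills w and is non-zero at r. Such a polynomial isolates
an r-eigenvector from lower terms when V is infinite-dimensional. -/
theorem exists_polynomial_of_mem_lowerEigenspan {T : Module.End ℂ V} {r : ℝ} {w : V}
    (hw : w ∈ lowerEigenspan T r) :
    ∃ p : Polynomial ℂ, Polynomial.aeval T p w = 0 ∧ p.eval (r : ℂ) ≠ 0 := by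
  induction hw using Submodule.span_induction with
  | mem w hw =>
    obtain ⟨s, hs, hw⟩ := hw
    refine ⟨Polynomial.X - Polynomial.C (s : ℂ), by simp [hw], ?_⟩
    simp only [Polynomial.eval_sub, Polynomial.eval_X, Polynomial.eval_C]
    exact sub_ne_zero.2 fun h => hs.ne' (by exact_mod_cast h)
  | zero => exact ⟨1, by simp, by simp⟩
  | add a b _ _ ha hb =>
    obtain ⟨p, hp, hp'⟩ := ha
    obtain ⟨q, hq, hq'⟩ := hb
    refine ⟨p * q, ?_, by simp [hp', hq']⟩
    rw [map_add]
    nth_rewrite 1 [mul_comm]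
    rw [map_mul, map_mul, Module.End.mul_apply, Module.End.mul_apply, hp, hq, map_zero, map_zero,
      add_zero]
  | smul c a _ ha =>
    obtain ⟨p, hp, hp'⟩ := ha
    exact ⟨p, by rw [map_smul, hp, smul_zero], hp'⟩

theorem aeval_apply_of_eigenvector {T : Module.End ℂ V} {c : ℂ} {v : V} (hv : T v = c • v)
    (p : Polynomial ℂ) : Polynomial.aeval T p v = p.eval c • v := by
  induction p using Polynomial.induction_on' with
  | add p q hp hq => simp [hp, hq, add_smul]
  | monomial k a =>
    have hk : ∀ k : ℕ, (T ^ k) v = c ^ k • v := by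
      intro k
      induction k with
      | zero => simp
      | succ k ih => rw [pow_succ', Module.End.mul_apply, ih, map_smul, hv, smul_smul, pow_succ]
    simp [Polynomial.aeval_monomial, hk, smul_smul, mul_comm]

theorem aeval_mem_of_stable {T : Module.End ℂ V} {Q : Submodule ℂ V} (hQ : ∀ u ∈ Q, T u ∈ Q)
    (p : Polynomial ℂ) {u : V} (hu : u ∈ Q) : Polynomial.aeval T p u ∈ Q := by
  induction p using Polynomial.induction_on' with
  | add p q hp hq => simpa using Q.add_mem hp hq
  | monomial k a =>
    have hk : ∀ k : ℕ, (T ^ k) u ∈ Q := by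
      intro k
      induction k with
      | zero => simpa using hu
      | succ k ih => rw [pow_succ', Module.End.mul_apply]; exact hQ _ ih
    simpa [Polynomial.aeval_monomial] using Q.smul_mem a (hk k)

/-- The span of the eigenvectors of `ad H` with negative eigenvalue. -/
def negativePart (H : 𝔩) : Submodule ℂ 𝔩 :=
  Submodule.span ℂ {y | ∃ r : ℝ, r < 0 ∧ ⁅H, y⁆ = (r : ℂ) • y}

/-- A cyclic representation generated by a vector `v` which is an `H`-eigenvector and an
eigenvector of a complement of the negative part of `𝔩`, is the sum of the line through `v` and
of lower eigenspaces of `H`. -/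
theorem IsCyclicVector.span_sup_lowerEigenspan {ρ : 𝔩 →ₗ[ℂ] Module.End ℂ V} {v : V}
    (hv : IsCyclicVector ρ v) (hρ : ∀ x y u, ρ ⁅x, y⁆ u = ρ x (ρ y u) - ρ y (ρ x u))
    {H : 𝔩} {r : ℝ} (hH : ρ H v = (r : ℂ) • v)
    (hn : ∀ x, ∃ y ∈ negativePart H, ∃ c : ℂ, ρ (x - y) v = c • v) :
    Submodule.span ℂ {v} ⊔ lowerEigenspan (ρ H) r = ⊤ := by
  refine hv.eq_top_of_stable hρ hn
    (Submodule.mem_sup_left (Submodule.mem_span_singleton_self v)) ?_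
  intro y hy u hu
  have hshift : ∀ (a s : ℝ) (y : 𝔩) (u : V), a < 0 → s ≤ r → ⁅H, y⁆ = (a : ℂ) • y →
      ρ H u = (s : ℂ) • u → ρ y u ∈ lowerEigenspan (ρ H) r := by
    intro a s y u ha hs hy hu
    refine Submodule.subset_span ⟨a + s, by linarith, ?_⟩
    have h1 : ρ H (ρ y u) = ρ ⁅H, y⁆ u + ρ y (ρ H u) := by rw [hρ]; abel
    rw [h1, hy, hu, map_smul, map_smul, LinearMap.smul_apply, ← add_smul]
    push_cast
    rfl
  induction hy using Submodule.span_induction with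
  | mem y hy =>
    obtain ⟨a, ha, hy⟩ := hy
    refine Submodule.mem_sup_right ?_
    have hle : Submodule.span ℂ {v} ⊔ lowerEigenspan (ρ H) r ≤
        (lowerEigenspan (ρ H) r).comap (ρ y) := by
      refine sup_le (Submodule.span_le.2 ?_) (Submodule.span_le.2 ?_)
      · rintro _ rfl
        exact hshift a r y _ ha le_rfl hy hH
      · rintro u ⟨s, hs, hu⟩
        exact hshift a s y u ha hs.le hy hu
    exact hle hu
  | zero => rw [map_zero]; exact Submodule.zero_mem _
  | add a b _ _ ha hb => rw [map_add]; exact Submodule.add_mem _ ha hb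
  | smul c a _ ha => rw [map_smul]; exact Submodule.smul_mem _ _ ha

/-- An intertwining map from a highest weight representation to a unitary representation kills
all proper subrepresentations. -/
theorem IsCyclicVector.map_eq_zero_of_ne_top {ρ : 𝔩 →ₗ[ℂ] Module.End ℂ V} {v : V}
    (hv : IsCyclicVector ρ v) (hρ : ∀ x y u, ρ ⁅x, y⁆ u = ρ x (ρ y u) - ρ y (ρ x u))
    {H : 𝔩} {r : ℝ} (hH : ρ H v = (r : ℂ) • v)
    (hn : ∀ x, ∃ y ∈ negativePart H, ∃ c : ℂ, ρ (x - y) v = c • v)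
    {M : Type*} [AddCommGroup M] [Module ℂ M] {σ : 𝔩 → Module.End ℂ M} {star : 𝔩 → 𝔩}
    (hstar : star H = H) {B : M →ₗ⋆[ℂ] M →ₗ[ℂ] ℂ} (hpos : ∀ m, m ≠ 0 → 0 < (B m m).re)
    (hB : ∀ x m m', B (σ x m) m' = B m (σ (star x) m'))
    {φ : V →ₗ[ℂ] M} (hφ : ∀ x u, φ (ρ x u) = σ x (φ u))
    {Q : Submodule ℂ V} (hQ : ∀ x, ∀ u ∈ Q, ρ x u ∈ Q) (hne : Q ≠ ⊤) {q : V} (hq : q ∈ Q) :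
    φ q = 0 := by
  -- H acts symmetrically for B, so eigenvectors with distinct real eigenvalues are orthogonal.
  have hlow : ∀ w ∈ lowerEigenspan (ρ H) r, B (φ v) (φ w) = 0 := by
    intro w hw
    induction hw using Submodule.span_induction with
    | mem w hw =>
      obtain ⟨s, hs, hw⟩ := hw
      have h1 := hB H (φ v) (φ w)
      rw [hstar, ← hφ, ← hφ, hH, hw] at h1
      simp only [map_smul, LinearMap.map_smulₛₗ, LinearMap.smul_apply, smul_eq_mul,
        Complex.conj_ofReal] at h1
      have h2 : ((r : ℂ) - s) * B (φ v) (φ w) = 0 := by rw [sub_mul, h1, sub_self]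
      rcases mul_eq_zero.1 h2 with h | h
      · exact absurd (by exact_mod_cast sub_eq_zero.1 h) hs.ne'
      · exact h
    | zero => simp
    | add a b _ _ ha hb => rw [map_add, map_add, ha, hb, add_zero]
    | smul c a _ ha => rw [map_smul, map_smul, ha, smul_zero]
  have horth : ∀ q ∈ Q, B (φ v) (φ q) = 0 := by
    intro q hq
    have hqt : q ∈ Submodule.span ℂ {v} ⊔ lowerEigenspan (ρ H) r := by
      rw [hv.span_sup_lowerEigenspan hρ hH hn]; trivial
    obtain ⟨a, ha, w, hw, rfl⟩ := Submodule.mem_sup.1 hqt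
    obtain ⟨c, rfl⟩ := Submodule.mem_span_singleton.1 ha
    by_cases hc : c = 0
    · rw [hc, zero_smul, zero_add]; exact hlow w hw
    exfalso
    -- p(H) kills w and scales v by p(r) ≠ 0, so v would lie in Q, and Q would be everything.
    obtain ⟨p, hp, hp'⟩ := exists_polynomial_of_mem_lowerEigenspan hw
    have h1 := aeval_mem_of_stable (hQ H) p hq
    rw [map_add, hp, add_zero, map_smul, aeval_apply_of_eigenvector hH, smul_smul] at h1
    exact hne (hv Q ((Submodule.smul_mem_iff _ (mul_ne_zero hc hp')).1 h1) hQ)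
  -- The vectors whose image is orthogonal to φ(Q). It contains v by `horth` and is stable by
  -- contravariance, so it is all of V; then φ(q) is orthogonal to itself.
  let K : Submodule ℂ V :=
    { carrier := {u | ∀ q ∈ Q, B (φ u) (φ q) = 0}
      zero_mem' := fun q _ => by simp
      add_mem' := fun {a b} ha hb q hq => by
        rw [map_add, map_add, LinearMap.add_apply, ha q hq, hb q hq, add_zero]
      smul_mem' := fun c a ha q hq => by
        rw [map_smul, LinearMap.map_smulₛₗ, LinearMap.smul_apply, ha q hq, smul_zero] }
  have hK : K = ⊤ := by
    refine hv K horth fun x u hu q hq => ?_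
    rw [hφ, hB, ← hφ]
    exact hu _ (hQ _ _ hq)
  have hqK : q ∈ K := by rw [hK]; trivial
  by_contra h
  have h1 := hpos _ h
  rw [hqK q hq] at h1
  simp at h1

end Representations

/-! ### Positive definite hermitian forms -/

section Forms

/-- The inner product given by a positive definite hermitian form. -/
@[reducible]
def innerCoreOfForm {V : Type*} [AddCommGroup V] [Module ℂ V] (B : V →ₗ⋆[ℂ] V →ₗ[ℂ] ℂ)
    (hsymm : ∀ v w, B w v = starRingEnd ℂ (B v w)) (hpos : ∀ v, v ≠ 0 → 0 < (B v v).re) :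
    InnerProductSpace.Core ℂ V where
  inner v w := B v w
  conj_inner_symm v w := (hsymm w v).symm
  re_inner_nonneg v := by
    by_cases hv : v = 0
    · simp [hv]
    · exact (hpos v hv).le
  add_left u v w := by simp
  smul_left v w c := by simp
  definite v hv := by
    by_contra h
    have := hpos v h
    rw [hv] at this
    simp at this

/-- The tensor product of two positive definite hermitian forms is positive definite. -/
theorem exists_tensor_form {V W : Type*} [AddCommGroup V] [Module ℂ V] [AddCommGroup W]
    [Module ℂ W] (B : V →ₗ⋆[ℂ] V →ₗ[ℂ] ℂ)
    (hBsymm : ∀ v w, B w v = starRingEnd ℂ (B v w)) (hBpos : ∀ v, v ≠ 0 → 0 < (B v v).re)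
    (B' : W →ₗ⋆[ℂ] W →ₗ[ℂ] ℂ)
    (hBsymm' : ∀ v w, B' w v = starRingEnd ℂ (B' v w)) (hBpos' : ∀ v, v ≠ 0 → 0 < (B' v v).re) :
    ∃ D : V ⊗[ℂ] W →ₗ⋆[ℂ] V ⊗[ℂ] W →ₗ[ℂ] ℂ,
      (∀ v w, D w v = starRingEnd ℂ (D v w)) ∧ (∀ v, v ≠ 0 → 0 < (D v v).re) ∧
      ∀ v w v' w', D (v ⊗ₜ w) (v' ⊗ₜ w') = B v v' * B' w w' := by
  let cV := innerCoreOfForm B hBsymm hBpos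
  let cW := innerCoreOfForm B' hBsymm' hBpos'
  let nV : NormedAddCommGroup V := cV.toNormedAddCommGroup
  let iV : InnerProductSpace ℂ V := InnerProductSpace.ofCore cV.toCore
  let nW : NormedAddCommGroup W := cW.toNormedAddCommGroup
  let iW : InnerProductSpace ℂ W := InnerProductSpace.ofCore cW.toCore
  -- With both forms read as inner products, positivity on sums of pure tensors is that of the inner
  -- product on V ⊗ W.
  refine ⟨innerₛₗ ℂ, fun v w => ?_, fun v hv => ?_, fun v w v' w' => ?_⟩
  · exact (inner_conj_symm w v).symm
  · by_contra h
    exact hv ((re_inner_self_nonpos (𝕜 := ℂ)).1 (not_lt.1 h))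
  · rfl

/-- Simultaneous diagonalization of a commuting family of operators that are symmetric with
respect to a positive definite hermitian form. -/
theorem span_joint_eigenvectors_eq_top {E T : Type*} [AddCommGroup E] [Module ℂ E]
    [FiniteDimensional ℂ E] [AddCommGroup T] [Module ℝ T] (B : E →ₗ⋆[ℂ] E →ₗ[ℂ] ℂ)
    (hBsymm : ∀ v w, B w v = starRingEnd ℂ (B v w)) (hBpos : ∀ v, v ≠ 0 → 0 < (B v v).re)
    (A : T → Module.End ℂ E) (hadd : ∀ s t, A (s + t) = A s + A t)
    (hsmul : ∀ (c : ℝ) t, A (c • t) = (c : ℂ) • A t)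
    (hcomm : ∀ s t, Commute (A s) (A t)) (hA : ∀ t v w, B (A t v) w = B v (A t w)) :
    Submodule.span ℂ {x : E | ∃ α : Module.Dual ℝ T, ∀ t, A t x = (α t : ℂ) • x} = ⊤ := by
  let cE := innerCoreOfForm B hBsymm hBpos
  let nE : NormedAddCommGroup E := cE.toNormedAddCommGroup
  let iE : InnerProductSpace ℂ E := InnerProductSpace.ofCore cE.toCore
  have hsym : ∀ t, (A t).IsSymmetric := fun t v w => hA t v w
  have htop := LinearMap.IsSymmetric.iSup_iInf_eq_top_of_commute hsym fun s t _ => hcomm s t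
  rw [eq_top_iff, ← htop]
  refine iSup_le fun χ x hx => ?_
  by_cases hx0 : x = 0
  · rw [hx0]; exact Submodule.zero_mem _
  have hχ : ∀ t, A t x = χ t • x := fun t =>
    Module.End.mem_eigenspace_iff.1 ((Submodule.mem_iInf _).1 hx t)
  -- Symmetry makes the joint eigenvalues real, and x ≠ 0 then forces them to depend linearly on t.
  have hreal : ∀ t, ((χ t).re : ℂ) = χ t := fun t =>
    Complex.conj_eq_iff_re.1 ((hsym t).conj_eigenvalue_eq_self
      (Module.End.hasEigenvalue_of_hasEigenvector
        ⟨Module.End.mem_eigenspace_iff.2 (hχ t), hx0⟩))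
  refine Submodule.subset_span ⟨{ toFun := fun t => (χ t).re, map_add' := ?_, map_smul' := ?_ }, ?_⟩
  · intro s t
    have h : χ (s + t) = χ s + χ t := smul_left_injective ℂ hx0 <| by
      change χ (s + t) • x = (χ s + χ t) • x
      rw [← hχ, hadd, LinearMap.add_apply, hχ, hχ, add_smul]
    rw [h, Complex.add_re]
  · intro c t
    have h : χ (c • t) = (c : ℂ) * χ t := smul_left_injective ℂ hx0 <| by
      change χ (c • t) • x = ((c : ℂ) * χ t) • x
      rw [← hχ, hsmul, LinearMap.smul_apply, hχ, smul_smul]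
    rw [h]
    simp
  · intro t
    change A t x = ((χ t).re : ℂ) • x
    rw [hreal, hχ]

end Forms

/-! ### Real and imaginary parts in 𝔤_ℂ -/

section Complexification

variable {𝔤 : Type u} [LieRing 𝔤] [LieAlgebra ℝ 𝔤]

theorem Cplx.induction {p : Cplx 𝔤 → Prop} (zero : p 0) (tmul : ∀ z X, p (Cplx.tmul z X))
    (add : ∀ x y, p x → p y → p (x + y)) (x : Cplx 𝔤) : p x :=
  TensorProduct.induction_on (motive := p) x zero tmul add

/-- The component `X` of the element `X + i Y` of `𝔤_ℂ`. -/
def cplxRe : Cplx 𝔤 →+ 𝔤 :=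
  ((TensorProduct.lid ℝ 𝔤).toLinearMap ∘ₗ LinearMap.rTensor 𝔤 Complex.reLm).toAddMonoidHom

/-- The component `Y` of the element `X + i Y` of `𝔤_ℂ`. -/
def cplxIm : Cplx 𝔤 →+ 𝔤 :=
  ((TensorProduct.lid ℝ 𝔤).toLinearMap ∘ₗ LinearMap.rTensor 𝔤 Complex.imLm).toAddMonoidHom

theorem cplxRe_tmul (z : ℂ) (X : 𝔤) : cplxRe (Cplx.tmul z X) = z.re • X := rfl

theorem cplxIm_tmul (z : ℂ) (X : 𝔤) : cplxIm (Cplx.tmul z X) = z.im • X := rfl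

theorem Cplx.tmul_add (z : ℂ) (X Y : 𝔤) :
    Cplx.tmul z (X + Y) = Cplx.tmul z X + Cplx.tmul z Y := TensorProduct.tmul_add z X Y

theorem Cplx.add_tmul (z w : ℂ) (X : 𝔤) :
    Cplx.tmul (z + w) X = Cplx.tmul z X + Cplx.tmul w X := TensorProduct.add_tmul z w X

theorem Cplx.tmul_zero (z : ℂ) : Cplx.tmul z (0 : 𝔤) = 0 := TensorProduct.tmul_zero 𝔤 z

theorem Cplx.tmul_smul (z : ℂ) (r : ℝ) (X : 𝔤) :
    Cplx.tmul z (r • X) = Cplx.tmul (z * r) X := by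
  change z ⊗ₜ[ℝ] (r • X) = (z * r) ⊗ₜ[ℝ] X
  rw [← TensorProduct.smul_tmul, Complex.real_smul, mul_comm]

theorem toCplx_cplxRe_add_iMul_cplxIm (x : Cplx 𝔤) :
    toCplx (cplxRe x) + iMul (cplxIm x) = x := by
  induction x using Cplx.induction with
  | zero => simp [toCplx, iMul, Cplx.tmul_zero]
  | tmul z X =>
    rw [cplxRe_tmul, cplxIm_tmul, toCplx, iMul, Cplx.tmul_smul, Cplx.tmul_smul, ← Cplx.add_tmul,
      one_mul, mul_comm, Complex.re_add_im]
  | add x y hx hy =>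
    nth_rewrite 3 [← hx]
    nth_rewrite 3 [← hy]
    simp only [toCplx, iMul, map_add, Cplx.tmul_add]
    abel

theorem cplxRe_toCplx (X : 𝔤) : cplxRe (toCplx X) = X := by simp [toCplx, cplxRe_tmul]
theorem cplxIm_toCplx (X : 𝔤) : cplxIm (toCplx X) = 0 := by simp [toCplx, cplxIm_tmul]
theorem cplxRe_iMul (X : 𝔤) : cplxRe (iMul X) = 0 := by simp [iMul, cplxRe_tmul]
theorem cplxIm_iMul (X : 𝔤) : cplxIm (iMul X) = X := by simp [iMul, cplxIm_tmul]

theorem Cplx.ext_re_im {x y : Cplx 𝔤} (hre : cplxRe x = cplxRe y) (him : cplxIm x = cplxIm y) :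
    x = y := by
  rw [← toCplx_cplxRe_add_iMul_cplxIm x, hre, him, toCplx_cplxRe_add_iMul_cplxIm]

theorem iMul_eq_smul_toCplx (X : 𝔤) : iMul X = Complex.I • toCplx X := by
  rw [iMul, toCplx, Cplx.smul_tmul, mul_one]

theorem toCplx_eq_smul_iMul (X : 𝔤) : toCplx X = (-Complex.I) • iMul X := by
  rw [iMul, toCplx, Cplx.smul_tmul, neg_mul, Complex.I_mul_I, neg_neg]

theorem cplxRe_smul (c : ℂ) (x : Cplx 𝔤) :
    cplxRe (c • x) = c.re • cplxRe x - c.im • cplxIm x := by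
  induction x using Cplx.induction with
  | zero => simp
  | tmul z X =>
    rw [Cplx.smul_tmul, cplxRe_tmul, cplxRe_tmul, cplxIm_tmul, Complex.mul_re, sub_smul, mul_smul,
      mul_smul]
  | add x y hx hy => rw [smul_add, map_add, hx, hy, map_add, map_add, smul_add, smul_add]; abel

theorem cplxIm_smul (c : ℂ) (x : Cplx 𝔤) :
    cplxIm (c • x) = c.re • cplxIm x + c.im • cplxRe x := by
  induction x using Cplx.induction with
  | zero => simp
  | tmul z X =>
    rw [Cplx.smul_tmul, cplxIm_tmul, cplxRe_tmul, cplxIm_tmul, Complex.mul_im, add_smul, mul_smul,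
      mul_smul]
  | add x y hx hy => rw [smul_add, map_add, hx, hy, map_add, map_add, smul_add, smul_add]; abel

theorem iMul_lie (T : 𝔤) (x : Cplx 𝔤) :
    ⁅iMul T, x⁆ = iMul ⁅T, cplxRe x⁆ - toCplx ⁅T, cplxIm x⁆ := by
  nth_rewrite 1 [← toCplx_cplxRe_add_iMul_cplxIm x]
  rw [lie_add, iMul, toCplx, iMul, Cplx.lie_tmul_tmul, Cplx.lie_tmul_tmul, mul_one,
    Complex.I_mul_I, sub_eq_add_neg, iMul, toCplx, ← neg_one_smul ℂ (Cplx.tmul 1 _),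
    Cplx.smul_tmul, mul_one]

theorem cplxRe_iMul_lie (T : 𝔤) (x : Cplx 𝔤) : cplxRe ⁅iMul T, x⁆ = -⁅T, cplxIm x⁆ := by
  rw [iMul_lie, map_sub, cplxRe_iMul, cplxRe_toCplx, zero_sub]

theorem cplxIm_iMul_lie (T : 𝔤) (x : Cplx 𝔤) : cplxIm ⁅iMul T, x⁆ = ⁅T, cplxRe x⁆ := by
  rw [iMul_lie, map_sub, cplxIm_iMul, cplxIm_toCplx, sub_zero]

theorem iMul_add (X Y : 𝔤) : iMul (X + Y) = iMul X + iMul Y := Cplx.tmul_add _ _ _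

theorem iMul_smul (r : ℝ) (X : 𝔤) : iMul (r • X) = (r : ℂ) • iMul X := by
  rw [iMul, iMul, Cplx.tmul_smul, Cplx.smul_tmul, mul_comm]

theorem iMul_lie_iMul (X Y : 𝔤) : ⁅iMul X, iMul Y⁆ = -toCplx ⁅X, Y⁆ := by
  rw [iMul_lie, cplxRe_iMul, cplxIm_iMul, lie_zero, iMul, Cplx.tmul_zero, zero_sub]

theorem cplxStar_iMul (X : 𝔤) : cplxStar (iMul X) = iMul X := by
  rw [cplxStar, iMul, cplxConj_tmul, Complex.conj_I, ← neg_one_smul ℂ (Cplx.tmul _ _),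
    Cplx.smul_tmul, neg_one_mul, neg_neg]

theorem cplxStar_toCplx (X : 𝔤) : cplxStar (toCplx X) = -toCplx X := by
  rw [cplxStar, toCplx, cplxConj_tmul, map_one]

instance [FiniteDimensional ℝ 𝔤] : FiniteDimensional ℂ (Cplx 𝔤) :=
  inferInstanceAs (FiniteDimensional ℂ (ℂ ⊗[ℝ] 𝔤))

end Complexification

/-! ### The Cartan inner product and the centralizer of Z -/

namespace HermitianSymmetric

variable {𝔤 : Type u} [LieRing 𝔤] [LieAlgebra ℝ 𝔤] (S : HermitianSymmetric 𝔤)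

theorem killingForm_comp_θ (X Y : 𝔤) :
    killingForm ℝ 𝔤 (S.θ X) (S.θ Y) = killingForm ℝ 𝔤 X Y :=
  LieAlgebra.killingForm_of_equiv_apply S.θ X Y

theorem killingForm_θ_comm (X Y : 𝔤) :
    killingForm ℝ 𝔤 X (S.θ Y) = killingForm ℝ 𝔤 Y (S.θ X) := by
  rw [← S.killingForm_comp_θ, S.θ_invol, LieModule.traceForm_comm]

theorem eq_zero_of_central (S : HermitianSymmetric 𝔤) {X : 𝔤} (hX : ∀ Y : 𝔤, ⁅X, Y⁆ = 0) : X = 0 := by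
  by_contra h
  have h1 := S.θ_cartan X h
  have h2 : LieAlgebra.ad ℝ 𝔤 X = 0 := by ext Y; exact hX Y
  rw [killingForm_apply_apply, h2] at h1
  simp at h1

/-- A positive definite hermitian form on `𝔤_ℂ` for which the elements of `i 𝔨` act by symmetric
operators. -/
theorem exists_compact_form : ∃ B : Cplx 𝔤 →ₗ⋆[ℂ] Cplx 𝔤 →ₗ[ℂ] ℂ,
    (∀ v w, B w v = starRingEnd ℂ (B v w)) ∧ (∀ v, v ≠ 0 → 0 < (B v v).re) ∧
    ∀ T ∈ S.k, ∀ v w, B ⁅iMul T, v⁆ w = B v ⁅iMul T, w⁆ := by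
  -- The inner product attached to the Cartan involution; the form on 𝔤_ℂ is its sesquilinear
  -- extension.
  let b : 𝔤 → 𝔤 → ℝ := fun X Y => - killingForm ℝ 𝔤 X (S.θ Y)
  have hadd : ∀ X X' Y, b (X + X') Y = b X Y + b X' Y := fun X X' Y => by simp [b]; ring
  have hsub : ∀ X X' Y, b (X - X') Y = b X Y - b X' Y := fun X X' Y => by simp [b]; ring
  have hneg : ∀ X Y, b (-X) Y = -b X Y := fun X Y => by simp [b]
  have hsmul : ∀ (c : ℝ) X Y, b (c • X) Y = c * b X Y := fun c X Y => by simp [b]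
  have hcomm : ∀ X Y, b X Y = b Y X := fun X Y => by simp only [b]; rw [S.killingForm_θ_comm]
  have hadd' : ∀ X X' Y, b Y (X + X') = b Y X + b Y X' := fun X X' Y => by
    rw [hcomm, hadd, hcomm X, hcomm X']
  have hsub' : ∀ X X' Y, b Y (X - X') = b Y X - b Y X' := fun X X' Y => by
    rw [hcomm, hsub, hcomm X, hcomm X']
  have hneg' : ∀ X Y, b Y (-X) = -b Y X := fun X Y => by rw [hcomm, hneg, hcomm]
  have hsmul' : ∀ (c : ℝ) X Y, b Y (c • X) = c * b Y X := fun c X Y => by rw [hcomm, hsmul, hcomm]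
  -- Since θ T = T, invariance of the Killing form makes ad T skew for b; the factor i turns this
  -- into symmetry.
  have hskew : ∀ T ∈ S.k, ∀ X Y, b ⁅T, X⁆ Y = -b X ⁅T, Y⁆ := fun T hT X Y => by
    have hT' : S.θ T = T := hT
    simp only [b]
    rw [LieEquiv.map_lie, hT', ← lie_skew, map_neg, LinearMap.neg_apply, killingForm,
      LieModule.traceForm_apply_lie_apply]
  have hpos : ∀ X, X ≠ 0 → 0 < b X X := fun X hX => S.θ_cartan X hX
  have hzero : b 0 0 = 0 := by simp [b]
  refine ⟨LinearMap.mk₂'ₛₗ (starRingEnd ℂ) (RingHom.id ℂ)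
    (fun x y => ((b (cplxRe x) (cplxRe y) + b (cplxIm x) (cplxIm y) : ℝ) : ℂ) +
      ((b (cplxRe x) (cplxIm y) - b (cplxIm x) (cplxRe y) : ℝ) : ℂ) * Complex.I)
    ?_ ?_ ?_ ?_, ?_, ?_, ?_⟩
  · intro x x' y
    simp only [map_add, hadd]
    push_cast; ring
  · intro c x y
    apply Complex.ext <;> simp [cplxRe_smul, cplxIm_smul, hadd, hsub, hsmul] <;> ring
  · intro x x' y
    simp only [map_add, hadd']
    push_cast; ring
  · intro c x y
    apply Complex.ext <;> simp [cplxRe_smul, cplxIm_smul, hadd', hsub', hsmul'] <;> ring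
  · intro x y
    apply Complex.ext <;> simp [hcomm (cplxRe y), hcomm (cplxIm y)]
  · intro x hx
    simp only [LinearMap.mk₂'ₛₗ_apply]
    have h : 0 < b (cplxRe x) (cplxRe x) + b (cplxIm x) (cplxIm x) := by
      by_cases hr : cplxRe x = 0
      · have hi : cplxIm x ≠ 0 := fun hi => hx (Cplx.ext_re_im (by simpa) (by simpa))
        rw [hr, hzero, zero_add]
        exact hpos _ hi
      · refine add_pos_of_pos_of_nonneg (hpos _ hr) ?_
        by_cases hi : cplxIm x = 0
        · rw [hi, hzero]
        · exact (hpos _ hi).le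
    simpa using h
  · intro T hT x y
    simp only [LinearMap.mk₂'ₛₗ_apply, cplxRe_iMul_lie, cplxIm_iMul_lie, hneg, hneg', hskew T hT]
    push_cast; ring

theorem mem_kC_iff {x : Cplx 𝔤} : x ∈ S.kC ↔ cplxRe x ∈ S.k ∧ cplxIm x ∈ S.k := by
  constructor
  · intro hx
    change x ∈ Submodule.span ℂ (toCplx '' (S.k : Set 𝔤)) at hx
    induction hx using Submodule.span_induction with
    | mem x hx =>
      obtain ⟨X, hX, rfl⟩ := hx
      rw [cplxRe_toCplx, cplxIm_toCplx]
      exact ⟨hX, S.k.zero_mem⟩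
    | zero => simp
    | add x y _ _ hx hy =>
      rw [map_add, map_add]
      exact ⟨S.k.add_mem hx.1 hy.1, S.k.add_mem hx.2 hy.2⟩
    | smul c x _ hx =>
      rw [cplxRe_smul, cplxIm_smul]
      exact ⟨S.k.sub_mem (S.k.smul_mem _ hx.1) (S.k.smul_mem _ hx.2),
        S.k.add_mem (S.k.smul_mem _ hx.2) (S.k.smul_mem _ hx.1)⟩
  · rintro ⟨hr, hi⟩
    rw [← toCplx_cplxRe_add_iMul_cplxIm x, iMul_eq_smul_toCplx]
    exact S.kC.add_mem (Submodule.subset_span ⟨_, hr, rfl⟩)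
      (S.kC.smul_mem _ (Submodule.subset_span ⟨_, hi, rfl⟩))

theorem iMul_mem_kC {X : 𝔤} (hX : X ∈ S.k) : iMul X ∈ S.kC :=
  S.mem_kC_iff.2 ⟨by rw [cplxRe_iMul]; exact S.k.zero_mem, by rwa [cplxIm_iMul]⟩

theorem cplxStar_mem_kC {x : Cplx 𝔤} (hx : x ∈ S.kC) : cplxStar x ∈ S.kC := by
  rw [S.mem_kC_iff] at hx
  have h : cplxStar x = iMul (cplxIm x) - toCplx (cplxRe x) := by
    nth_rewrite 1 [← toCplx_cplxRe_add_iMul_cplxIm x]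
    have hadd : ∀ x y : Cplx 𝔤, cplxStar (x + y) = cplxStar x + cplxStar y := fun x y => by
      simp only [cplxStar, map_add]; abel
    rw [hadd, cplxStar_toCplx, cplxStar_iMul]; abel
  rw [S.mem_kC_iff, h, map_sub, map_sub, cplxRe_iMul, cplxRe_toCplx, cplxIm_iMul, cplxIm_toCplx]
  exact ⟨S.k.sub_mem S.k.zero_mem hx.1, S.k.sub_mem hx.2 S.k.zero_mem⟩

/-- In a simple algebra, `𝔨` contains the centralizer of an element `Z` of its center which is the
imaginary part of a grading element. -/
theorem mem_k_of_lie_eq_zero [LieAlgebra.IsSimple ℝ 𝔤] {Z : 𝔤} (hZ : S.MemCenterK Z) (hZ0 : Z ≠ 0)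
    (hcube : ∀ X : 𝔤, ⁅Z, ⁅Z, ⁅Z, X⁆⁆⁆ = -⁅Z, X⁆) {X : 𝔤} (hX : ⁅Z, X⁆ = 0) : X ∈ S.k := by
  have hθZ : S.θ Z = Z := hZ.1
  -- The centralizer of the range of ad Z. By `hcube`, 𝔤 is the sum of the kernel and the range of
  -- ad Z, and both preserve I, so I is an ideal.
  let I : LieIdeal ℝ 𝔤 :=
    { carrier := {x | ∀ y : 𝔤, ⁅x, ⁅Z, y⁆⁆ = 0}
      zero_mem' := fun y => zero_lie _
      add_mem' := fun {a b} ha hb y => by rw [add_lie, ha, hb, add_zero]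
      smul_mem' := fun c a ha y => by rw [smul_lie, ha, smul_zero]
      lie_mem := by
        intro w x hx y
        replace hx : ∀ y : 𝔤, ⁅x, ⁅Z, y⁆⁆ = 0 := hx
        have hcent : ∀ u : 𝔤, ⁅Z, u⁆ = 0 → ⁅x, ⁅u, ⁅Z, y⁆⁆⁆ = 0 := fun u hu => by
          rw [leibniz_lie u, ← lie_skew u Z, hu, neg_zero, zero_lie, zero_add, hx]
        have hrange : ∀ u : 𝔤, ⁅x, ⁅⁅Z, u⁆, ⁅Z, y⁆⁆⁆ = 0 := fun u => by
          rw [leibniz_lie, hx, zero_lie, hx, lie_zero, add_zero]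
        have hw : w = (w + ⁅Z, ⁅Z, w⁆⁆) - ⁅Z, ⁅Z, w⁆⁆ := by abel
        rw [lie_lie, hx, lie_zero, zero_sub, neg_eq_zero, hw, sub_lie, lie_sub, hrange, sub_zero]
        exact hcent _ (by rw [lie_add, hcube, add_neg_cancel]) }
  have hθk : ∀ {x y : 𝔤}, S.θ x = -x → S.θ y = -y → S.θ ⁅x, y⁆ = ⁅x, y⁆ := fun {x y} hx hy => by
    rw [LieEquiv.map_lie, hx, hy, neg_lie, lie_neg, neg_neg]
  -- Only y' = y - θ y contributes to [Z, y]. Then u = [x, [Z, y']] lies in 𝔨, and invariance gives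
  -- κ(u, u) = κ([[u, x], Z], y') = 0, because u and x both commute with Z. Definiteness of κ on 𝔨
  -- forces u = 0.
  have hxI : ∀ x, S.θ x = -x → ⁅Z, x⁆ = 0 → x ∈ I := by
    intro x hx hZx y
    have hZk : ⁅Z, y + S.θ y⁆ = 0 := hZ.2 _ (by
      change S.θ _ = _
      rw [map_add, S.θ_invol, add_comm])
    have hy : ⁅Z, y⁆ = (2⁻¹ : ℝ) • ⁅Z, y - S.θ y⁆ := by
      rw [lie_add] at hZk
      rw [lie_sub, ← neg_eq_of_add_eq_zero_right hZk, sub_neg_eq_add, ← two_smul ℝ, smul_smul]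
      norm_num
    have hp : S.θ ⁅Z, y - S.θ y⁆ = -⁅Z, y - S.θ y⁆ := by
      rw [LieEquiv.map_lie, hθZ, map_sub, S.θ_invol, ← lie_neg, neg_sub]
    rw [hy, lie_smul]
    set y' := y - S.θ y
    have hu := hθk hx hp
    have : ⁅x, ⁅Z, y'⁆⁆ = 0 := by
      by_contra hne
      have h1 := S.θ_cartan _ hne
      set u := ⁅x, ⁅Z, y'⁆⁆ with hu_def
      have h2 : ⁅⁅u, x⁆, Z⁆ = 0 := by
        rw [← lie_skew, leibniz_lie, hZx, lie_zero, add_zero, hZ.2 u hu, zero_lie, neg_zero]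
      rw [hu] at h1
      nth_rewrite 2 [hu_def] at h1
      rw [killingForm, ← LieModule.traceForm_apply_lie_apply,
        ← LieModule.traceForm_apply_lie_apply, h2] at h1
      simp at h1
    rw [this, smul_zero]
  -- If I were 𝔤, the range of ad Z would be central, hence zero; then Z would be central, hence
  -- zero.
  have hIbot : I = ⊥ := by
    refine (LieAlgebra.IsSimple.eq_bot_or_eq_top (R := ℝ) I).resolve_right fun htop => ?_
    have hall : ∀ x y : 𝔤, ⁅x, ⁅Z, y⁆⁆ = 0 := fun x y => by
      have hx : x ∈ I := by rw [htop]; trivial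
      exact hx y
    refine hZ0 (S.eq_zero_of_central fun y => S.eq_zero_of_central fun x => ?_)
    rw [← lie_skew, hall, neg_zero]
  have hmem : X - S.θ X ∈ I := hxI _ (by rw [map_sub, S.θ_invol, neg_sub]) (by
    have h1 : ⁅Z, S.θ X⁆ = 0 := by
      rw [← hθZ, ← LieEquiv.map_lie, hX, map_zero]
    rw [lie_sub, hX, h1, sub_zero])
  rw [hIbot, LieSubmodule.mem_bot, sub_eq_zero] at hmem
  exact hmem.symm

end HermitianSymmetric

/-! ### Root vectors and triangular decompositions -/

namespace HermitianSymmetric.CartanData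

variable {𝔤 : Type u} [LieRing 𝔤] [LieAlgebra ℝ 𝔤] {S : HermitianSymmetric 𝔤} (C : S.CartanData)

theorem Z₀_lie_eq {α : C.Weight} {x : Cplx 𝔤} (hx : x ∈ rootSpace C.t α) :
    ⁅C.Z₀, x⁆ = (α C.Zt : ℂ) • x := hx C.Zt

/-- The operators ad(iX), X in 𝔱, commute and are symmetric for the form of `exists_compact_form`,
so they are simultaneously diagonalizable. -/
theorem span_rootSpace_eq_top [FiniteDimensional ℝ 𝔤] :
    Submodule.span ℂ {x : Cplx 𝔤 | ∃ α : C.Weight, x ∈ rootSpace C.t α} = ⊤ := by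
  obtain ⟨B, hBsymm, hBpos, hB⟩ := S.exists_compact_form
  refine span_joint_eigenvectors_eq_top B hBsymm hBpos
    (fun X : C.t => LieModule.toEnd ℂ (Cplx 𝔤) (Cplx 𝔤) (iMul (X : 𝔤))) ?_ ?_ ?_ ?_
  · intro X Y
    change LieModule.toEnd ℂ (Cplx 𝔤) (Cplx 𝔤) (iMul ((X : 𝔤) + Y)) = _
    rw [iMul_add, map_add]
  · intro c X
    change LieModule.toEnd ℂ (Cplx 𝔤) (Cplx 𝔤) (iMul (c • (X : 𝔤))) = _
    rw [iMul_smul, map_smul]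
  · intro X Y
    refine LinearMap.ext fun x => ?_
    change ⁅iMul (X : 𝔤), ⁅iMul (Y : 𝔤), x⁆⁆ = ⁅iMul (Y : 𝔤), ⁅iMul (X : 𝔤), x⁆⁆
    rw [leibniz_lie, iMul_lie_iMul, C.t_abelian _ X.2 _ Y.2, toCplx, Cplx.tmul_zero, neg_zero,
      zero_lie, zero_add]
  · exact fun X v w => hB X (C.t_le X.2) v w

theorem apply_Zt_mem {α : C.Weight} {x : Cplx 𝔤} (hx : x ∈ rootSpace C.t α) (hx0 : x ≠ 0) :
    α C.Zt = 1 ∨ α C.Zt = 0 ∨ α C.Zt = -1 := by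
  have h : (α C.Zt : ℂ) ∈ spectrum ℂ (LieAlgebra.ad ℂ (Cplx 𝔤) (iMul C.Z)) :=
    (Module.End.hasEigenvalue_of_hasEigenvector
      ⟨Module.End.mem_eigenspace_iff.2 (C.Z₀_lie_eq hx), hx0⟩).mem_spectrum
  rw [C.Z_spec] at h
  rcases h with h | h | h
  · left; exact_mod_cast h
  · right; left; exact_mod_cast h
  · right; right
    have h' : (α C.Zt : ℂ) = -1 := h
    exact_mod_cast h'

/-- The spectrum alone would not give this identity: diagonalizability of ad Z₀ is also needed, and
comes from the span of root vectors. -/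
theorem Z₀_lie_cube [FiniteDimensional ℝ 𝔤] (x : Cplx 𝔤) :
    ⁅C.Z₀, ⁅C.Z₀, ⁅C.Z₀, x⁆⁆⁆ = ⁅C.Z₀, x⁆ := by
  have hx : x ∈ Submodule.span ℂ {x : Cplx 𝔤 | ∃ α : C.Weight, x ∈ rootSpace C.t α} := by
    rw [C.span_rootSpace_eq_top]; trivial
  induction hx using Submodule.span_induction with
  | mem x hx =>
    obtain ⟨α, hx⟩ := hx
    by_cases hx0 : x = 0
    · simp [hx0]
    rw [C.Z₀_lie_eq hx, lie_smul, C.Z₀_lie_eq hx, lie_smul, lie_smul, C.Z₀_lie_eq hx]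
    rcases C.apply_Zt_mem hx hx0 with h | h | h <;> rw [h] <;> simp
  | zero => simp
  | add x y _ _ hx hy => simp only [lie_add, hx, hy]
  | smul c x _ hx => simp only [lie_smul, hx]

theorem Z_lie_cube [FiniteDimensional ℝ 𝔤] (X : 𝔤) :
    ⁅C.Z, ⁅C.Z, ⁅C.Z, X⁆⁆⁆ = -⁅C.Z, X⁆ := by
  have h := congrArg cplxIm (C.Z₀_lie_cube (toCplx X))
  rw [Z₀, cplxIm_iMul_lie, cplxRe_iMul_lie, cplxIm_iMul_lie, cplxRe_toCplx, lie_neg] at h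
  exact neg_eq_iff_eq_neg.1 h

theorem Z_ne_zero : C.Z ≠ 0 := by
  intro h
  have h1 : (1 : ℂ) ∈ spectrum ℂ (LieAlgebra.ad ℂ (Cplx 𝔤) (iMul C.Z)) := by
    rw [C.Z_spec]; simp
  rw [h, iMul, Cplx.tmul_zero, map_zero] at h1
  rcases subsingleton_or_nontrivial (Module.End ℂ (Cplx 𝔤)) with hs | hn
  · rw [spectrum.of_subsingleton] at h1
    exact h1
  · rw [spectrum.zero_eq] at h1
    simp at h1

theorem mem_k_of_Z_lie_eq_zero [FiniteDimensional ℝ 𝔤] [LieAlgebra.IsSimple ℝ 𝔤]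
    {X : 𝔤} (hX : ⁅C.Z, X⁆ = 0) : X ∈ S.k :=
  S.mem_k_of_lie_eq_zero C.Z_center C.Z_ne_zero C.Z_lie_cube hX

/-- That the centralizer of Z₀ is no larger than 𝔨_ℂ rests on simplicity. It places root vectors for
roots vanishing at Z₀ inside 𝔨_ℂ. -/
theorem mem_kC_iff_Z₀_lie_eq_zero [FiniteDimensional ℝ 𝔤] [LieAlgebra.IsSimple ℝ 𝔤]
    {x : Cplx 𝔤} : x ∈ S.kC ↔ ⁅C.Z₀, x⁆ = 0 := by
  rw [S.mem_kC_iff, Z₀, iMul_lie]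
  constructor
  · rintro ⟨hr, hi⟩
    rw [C.Z_center.2 _ hr, C.Z_center.2 _ hi, iMul, toCplx, Cplx.tmul_zero, Cplx.tmul_zero,
      sub_zero]
  · intro h
    have hr := congrArg cplxIm h
    have hi := congrArg cplxRe h
    rw [map_sub, cplxIm_iMul, cplxIm_toCplx, sub_zero, map_zero] at hr
    rw [map_sub, cplxRe_iMul, cplxRe_toCplx, zero_sub, map_zero, neg_eq_zero] at hi
    exact ⟨C.mem_k_of_Z_lie_eq_zero hr, C.mem_k_of_Z_lie_eq_zero hi⟩

/-- Both parts of a vector of weight 0 commute with Z, so they lie in 𝔨, where 𝔱 is maximal abelian.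
-/
theorem cplxRe_mem_t_and_cplxIm_mem_t [FiniteDimensional ℝ 𝔤] [LieAlgebra.IsSimple ℝ 𝔤]
    {x : Cplx 𝔤} (hx : x ∈ rootSpace C.t 0) :
    cplxRe x ∈ C.t ∧ cplxIm x ∈ C.t := by
  have hx' : ∀ X : C.t, ⁅iMul (X : 𝔤), x⁆ = 0 := fun X => by
    rw [hx X, LinearMap.zero_apply, Complex.ofReal_zero, zero_smul]
  have hr : ∀ X ∈ C.t, ⁅X, cplxRe x⁆ = 0 := fun X hX => by
    rw [← cplxIm_iMul_lie, hx' ⟨X, hX⟩, map_zero]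
  have hi : ∀ X ∈ C.t, ⁅X, cplxIm x⁆ = 0 := fun X hX => by
    rw [← neg_eq_zero, ← cplxRe_iMul_lie, hx' ⟨X, hX⟩, map_zero]
  exact ⟨C.t_maximal _ (C.mem_k_of_Z_lie_eq_zero (hr _ C.Zt.2))
      fun Y hY => by rw [← lie_skew, hr Y hY, neg_zero],
    C.t_maximal _ (C.mem_k_of_Z_lie_eq_zero (hi _ C.Zt.2))
      fun Y hY => by rw [← lie_skew, hi Y hY, neg_zero]⟩

/-- A regular element of `𝔱` which defines the positive system. -/
theorem exists_regular : ∃ X : C.t, (∀ α ∈ roots C.t, α ∉ C.pos → α X < 0) ∧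
    ∀ α ∈ C.pos, α ∈ roots C.t := by
  obtain ⟨X, hX, hpos⟩ := C.pos_system
  refine ⟨X, fun α hα hα' => ?_, fun α hα => ?_⟩
  · rw [hpos] at hα'
    exact lt_of_le_of_ne (not_lt.1 fun h => hα' ⟨hα, h⟩) (hX α hα)
  · rw [hpos] at hα
    exact hα.1

/-- In the applications, here and in the decompositions below, ρ is the orbit map x ↦ x · v. -/
theorem exists_smul_of_re_im_mem_t {V : Type*} [AddCommGroup V] [Module ℂ V]
    {ρ : Cplx 𝔤 →ₗ[ℂ] V} {v : V} {lam : C.Weight}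
    (ht : ∀ X : C.t, ρ (iMul (X : 𝔤)) = (lam X : ℂ) • v) {x : Cplx 𝔤}
    (hx : cplxRe x ∈ C.t ∧ cplxIm x ∈ C.t) : ∃ c : ℂ, ρ x = c • v := by
  refine ⟨-Complex.I * lam ⟨_, hx.1⟩ + lam ⟨_, hx.2⟩, ?_⟩
  rw [add_smul, mul_smul, ← ht, ← ht, ← map_smul, ← map_add, ← toCplx_eq_smul_iMul,
    toCplx_cplxRe_add_iMul_cplxIm]

/-- The triangular decomposition of `𝔤_ℂ`, in terms of the stabilizer of the line through a
highest weight vector. -/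
theorem exists_negativePart [FiniteDimensional ℝ 𝔤] [LieAlgebra.IsSimple ℝ 𝔤]
    {V : Type*} [AddCommGroup V] [Module ℂ V]
    {ρ : Cplx 𝔤 →ₗ[ℂ] V} {v : V} {lam : C.Weight}
    (ht : ∀ X : C.t, ρ (iMul (X : 𝔤)) = (lam X : ℂ) • v)
    (hpos : ∀ α ∈ C.pos, ∀ x ∈ rootSpace C.t α, ρ x = 0) {X₀ : C.t}
    (hX₀ : ∀ α ∈ roots C.t, α ∉ C.pos → α X₀ < 0) (x : Cplx 𝔤) :
    ∃ y ∈ negativePart (iMul (X₀ : 𝔤)), ∃ c : ℂ, ρ (x - y) = c • v := by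
  have hx : x ∈ Submodule.span ℂ {x : Cplx 𝔤 | ∃ α : C.Weight, x ∈ rootSpace C.t α} := by
    rw [C.span_rootSpace_eq_top]; trivial
  induction hx using Submodule.span_induction with
  | mem x hx =>
    obtain ⟨α, hx⟩ := hx
    by_cases hx0 : x = 0
    · exact ⟨0, Submodule.zero_mem _, 0, by simp [hx0]⟩
    by_cases hα0 : α = 0
    · rw [hα0] at hx
      refine ⟨0, Submodule.zero_mem _, ?_⟩
      rw [sub_zero]
      exact C.exists_smul_of_re_im_mem_t ht (C.cplxRe_mem_t_and_cplxIm_mem_t hx)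
    by_cases hα : α ∈ C.pos
    · exact ⟨0, Submodule.zero_mem _, 0, by rw [sub_zero, hpos α hα x hx, zero_smul]⟩
    · exact ⟨x, Submodule.subset_span ⟨α X₀, hX₀ α ⟨hα0, x, hx, hx0⟩ hα, hx X₀⟩, 0, by simp⟩
  | zero => exact ⟨0, Submodule.zero_mem _, 0, by simp⟩
  | add a b _ _ ha hb =>
    obtain ⟨y, hy, c, hc⟩ := ha
    obtain ⟨z, hz, d, hd⟩ := hb
    exact ⟨y + z, Submodule.add_mem _ hy hz, c + d, by
      rw [add_sub_add_comm, map_add, hc, hd, add_smul]⟩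
  | smul r a _ ha =>
    obtain ⟨y, hy, c, hc⟩ := ha
    exact ⟨r • y, Submodule.smul_mem _ _ hy, r * c, by rw [← smul_sub, map_smul, hc, mul_smul]⟩

/-- The triangular decomposition of `𝔨_ℂ`, in terms of the stabilizer of the line through a
highest weight vector. -/
theorem exists_negativePart_kC [FiniteDimensional ℝ 𝔤] [LieAlgebra.IsSimple ℝ 𝔤]
    {V : Type*} [AddCommGroup V] [Module ℂ V]
    {ρ : S.kC →ₗ[ℂ] V} {v : V} {lam : C.Weight}
    (ht : ∀ X : C.t, ρ ⟨iMul (X : 𝔤), S.iMul_mem_kC (C.t_le X.2)⟩ = (lam X : ℂ) • v)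
    (hpos : ∀ α ∈ C.compactPos, ∀ x : S.kC, (x : Cplx 𝔤) ∈ rootSpace C.t α → ρ x = 0) {X₀ : C.t}
    (hX₀ : ∀ α ∈ roots C.t, α ∉ C.pos → α X₀ < 0) {H : S.kC} (hH : (H : Cplx 𝔤) = iMul (X₀ : 𝔤))
    (x : S.kC) : ∃ y ∈ negativePart H, ∃ c : ℂ, ρ (x - y) = c • v := by
  -- The operator 1 - ad(Z₀)² projects 𝔤_ℂ onto 𝔨_ℂ, which transfers the induction over root vectors
  -- of 𝔤_ℂ to 𝔨_ℂ.
  have key : ∀ x : Cplx 𝔤, ∃ z : S.kC, (z : Cplx 𝔤) = x - ⁅C.Z₀, ⁅C.Z₀, x⁆⁆ ∧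
      ∃ y ∈ negativePart H, ∃ c : ℂ, ρ (z - y) = c • v := by
    intro x
    have hx : x ∈ Submodule.span ℂ {x : Cplx 𝔤 | ∃ α : C.Weight, x ∈ rootSpace C.t α} := by
      rw [C.span_rootSpace_eq_top]; trivial
    induction hx using Submodule.span_induction with
    | mem x hx =>
      obtain ⟨α, hx⟩ := hx
      by_cases hx0 : x = 0
      · exact ⟨0, by simp [hx0], 0, Submodule.zero_mem _, 0, by simp⟩
      by_cases hαZ : α C.Zt = 0
      · have hZx : ⁅C.Z₀, x⁆ = 0 := by
          rw [C.Z₀_lie_eq hx, hαZ, Complex.ofReal_zero, zero_smul]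
        have hxk : x ∈ S.kC := C.mem_kC_iff_Z₀_lie_eq_zero.2 hZx
        refine ⟨⟨x, hxk⟩, by change x = _; rw [hZx, lie_zero, sub_zero], ?_⟩
        by_cases hα0 : α = 0
        · rw [hα0] at hx
          obtain ⟨hr, hi⟩ := C.cplxRe_mem_t_and_cplxIm_mem_t hx
          refine ⟨0, Submodule.zero_mem _, -Complex.I * lam ⟨_, hr⟩ + lam ⟨_, hi⟩, ?_⟩
          let a : S.kC := ⟨iMul (cplxRe x), S.iMul_mem_kC (C.t_le hr)⟩
          let b : S.kC := ⟨iMul (cplxIm x), S.iMul_mem_kC (C.t_le hi)⟩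
          have ha : ρ a = (lam ⟨_, hr⟩ : ℂ) • v := ht ⟨_, hr⟩
          have hb : ρ b = (lam ⟨_, hi⟩ : ℂ) • v := ht ⟨_, hi⟩
          have hdec : (⟨x, hxk⟩ : S.kC) = (-Complex.I) • a + b := by
            apply Subtype.ext
            change x = (-Complex.I) • iMul (cplxRe x) + iMul (cplxIm x)
            rw [← toCplx_eq_smul_iMul, toCplx_cplxRe_add_iMul_cplxIm]
          rw [sub_zero, hdec, map_add, map_smul, ha, hb, add_smul, mul_smul]
        by_cases hα : α ∈ C.pos
        · exact ⟨0, Submodule.zero_mem _, 0, by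
            rw [sub_zero, hpos α ⟨hα, hαZ⟩ ⟨x, hxk⟩ hx, zero_smul]⟩
        · refine ⟨⟨x, hxk⟩, Submodule.subset_span ⟨α X₀, hX₀ α ⟨hα0, x, hx, hx0⟩ hα, ?_⟩, 0, ?_⟩
          · apply Subtype.ext
            change ⁅(H : Cplx 𝔤), x⁆ = (α X₀ : ℂ) • x
            rw [hH, hx X₀]
          · rw [sub_self, map_zero, zero_smul]
      · refine ⟨0, ?_, 0, Submodule.zero_mem _, 0, by simp⟩
        rw [C.Z₀_lie_eq hx, lie_smul, C.Z₀_lie_eq hx]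
        rcases C.apply_Zt_mem hx hx0 with h | h | h
        · rw [h]; simp
        · exact absurd h hαZ
        · rw [h]; simp
    | zero => exact ⟨0, by simp, 0, Submodule.zero_mem _, 0, by simp⟩
    | add a b _ _ ha hb =>
      obtain ⟨z, hz, y, hy, c, hc⟩ := ha
      obtain ⟨z', hz', y', hy', c', hc'⟩ := hb
      refine ⟨z + z', ?_, y + y', Submodule.add_mem _ hy hy', c + c', by
        rw [add_sub_add_comm, map_add, hc, hc', add_smul]⟩
      change (z : Cplx 𝔤) + z' = _
      rw [hz, hz', lie_add, lie_add]
      abel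
    | smul r a _ ha =>
      obtain ⟨z, hz, y, hy, c, hc⟩ := ha
      refine ⟨r • z, ?_, r • y, Submodule.smul_mem _ _ hy, r * c, by
        rw [← smul_sub, map_smul, hc, mul_smul]⟩
      change r • (z : Cplx 𝔤) = _
      rw [hz, lie_smul, lie_smul, smul_sub]
  obtain ⟨z, hz, h⟩ := key x
  have hzx : z = x := Subtype.ext (by
    rw [hz, C.mem_kC_iff_Z₀_lie_eq_zero.1 x.2, lie_zero, sub_zero])
  rwa [hzx] at h

/-- A linear map that vanishes on the positive root vectors vanishes on `𝔭⁺`. -/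
theorem apply_eq_zero_of_Z₀_lie_eq [FiniteDimensional ℝ 𝔤] {V : Type*} [AddCommGroup V]
    [Module ℂ V] {ρ : Cplx 𝔤 →ₗ[ℂ] V} (hpos : ∀ α ∈ C.pos, ∀ x ∈ rootSpace C.t α, ρ x = 0)
    {x : Cplx 𝔤} (hx : ⁅C.Z₀, x⁆ = x) : ρ x = 0 := by
  -- ad(Z₀)² + ad(Z₀) is 2 on 𝔭⁺ and 0 in degrees 0 and -1, so the claim can be tested on root
  -- vectors.
  have key : ∀ x, ρ (⁅C.Z₀, ⁅C.Z₀, x⁆⁆ + ⁅C.Z₀, x⁆) = 0 := by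
    intro x
    have hx : x ∈ Submodule.span ℂ {x : Cplx 𝔤 | ∃ α : C.Weight, x ∈ rootSpace C.t α} := by
      rw [C.span_rootSpace_eq_top]; trivial
    induction hx using Submodule.span_induction with
    | mem x hx =>
      obtain ⟨α, hx⟩ := hx
      by_cases hx0 : x = 0
      · simp [hx0]
      rw [C.Z₀_lie_eq hx, lie_smul, C.Z₀_lie_eq hx]
      rcases C.apply_Zt_mem hx hx0 with h | h | h
      · have h0 : α C.Zt ≠ 0 := by rw [h]; exact one_ne_zero
        have hα : α ∈ roots C.t := ⟨fun hα => h0 (by rw [hα, LinearMap.zero_apply]), x, hx, hx0⟩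
        rw [map_add, map_smul, map_smul, hpos α ((C.pos_noncompact α hα h0).2 h) x hx]
        simp
      · rw [h]; simp
      · rw [h]; simp
    | zero => simp
    | add a b _ _ ha hb =>
      rw [map_add] at ha hb
      simp only [lie_add, map_add]
      rw [add_add_add_comm, ha, hb, add_zero]
    | smul c a _ ha => rw [lie_smul, lie_smul, ← smul_add, map_smul, ha, smul_zero]
  have h := key x
  rw [hx, hx, ← two_smul ℂ, map_smul] at h
  exact (smul_eq_zero.1 h).resolve_left two_ne_zero

/-! ### The decomposition `𝔤_ℂ = 𝔥_ℂ + 𝔟` -/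

variable (S) in
/-- The complex linear extension of `τ` to `𝔤_ℂ`. -/
def tauC (x : Cplx 𝔤) : Cplx 𝔤 := toCplx (S.τ (cplxRe x)) + iMul (S.τ (cplxIm x))

theorem cplxRe_tauC (x : Cplx 𝔤) : cplxRe (tauC S x) = S.τ (cplxRe x) := by
  rw [tauC, map_add, cplxRe_toCplx, cplxRe_iMul, add_zero]

theorem cplxIm_tauC (x : Cplx 𝔤) : cplxIm (tauC S x) = S.τ (cplxIm x) := by
  rw [tauC, map_add, cplxIm_toCplx, cplxIm_iMul, zero_add]

theorem tauC_tauC (x : Cplx 𝔤) : tauC S (tauC S x) = x :=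
  Cplx.ext_re_im (by rw [cplxRe_tauC, cplxRe_tauC, S.τ_invol])
    (by rw [cplxIm_tauC, cplxIm_tauC, S.τ_invol])

theorem tauC_ne_zero {x : Cplx 𝔤} (hx : x ≠ 0) : tauC S x ≠ 0 := by
  intro h
  apply hx
  rw [← tauC_tauC (S := S) x, h]
  exact Cplx.ext_re_im (by rw [cplxRe_tauC, map_zero, map_zero])
    (by rw [cplxIm_tauC, map_zero, map_zero])

/-- The involution `τ` of `𝔱`. -/
def tauT : C.t →ₗ[ℝ] C.t where
  toFun X := ⟨S.τ X, C.t_stable X X.2⟩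
  map_add' X Y := Subtype.ext (map_add S.τ (X : 𝔤) (Y : 𝔤))
  map_smul' c X := Subtype.ext (map_smul S.τ c (X : 𝔤))

theorem tauT_of_mem_tq {X : C.t} (hX : X ∈ S.tq C.t) : C.tauT X = -X := by
  have h : S.τ (X : 𝔤) = -(X : 𝔤) := hX
  exact Subtype.ext h

theorem tauC_mem_rootSpace {α : C.Weight} {x : Cplx 𝔤} (hx : x ∈ rootSpace C.t α) :
    tauC S x ∈ rootSpace C.t (α.comp C.tauT) := by
  intro X
  have h := hx (C.tauT X)
  have hr := congrArg cplxRe h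
  have hi := congrArg cplxIm h
  have hX : ((C.tauT X : C.t) : 𝔤) = S.τ X := rfl
  rw [cplxRe_iMul_lie, cplxRe_smul, hX] at hr
  rw [cplxIm_iMul_lie, cplxIm_smul, hX] at hi
  simp only [Complex.ofReal_re, Complex.ofReal_im, zero_smul, sub_zero, add_zero] at hr hi
  apply Cplx.ext_re_im
  · rw [cplxRe_iMul_lie, cplxRe_smul, cplxRe_tauC, cplxIm_tauC]
    simp only [Complex.ofReal_re, Complex.ofReal_im, zero_smul, sub_zero]
    have := congrArg S.τ hr
    rwa [map_neg, LieEquiv.map_lie, S.τ_invol, map_smul] at this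
  · rw [cplxIm_iMul_lie, cplxIm_smul, cplxIm_tauC, cplxRe_tauC]
    simp only [Complex.ofReal_re, Complex.ofReal_im, zero_smul, add_zero]
    have := congrArg S.τ hi
    rwa [LieEquiv.map_lie, S.τ_invol, map_smul] at this

/-- Conjugation with respect to 𝔤 sends iX to -iX and fixes the real number α(X), so it exchanges
the root spaces of α and -α. -/
theorem neg_mem_roots {α : C.Weight} (hα : α ∈ roots C.t) : -α ∈ roots C.t := by
  obtain ⟨h0, x, hx, hx0⟩ := hα
  refine ⟨neg_ne_zero.2 h0, toCplx (cplxRe x) - iMul (cplxIm x), fun X => ?_, fun h => hx0 ?_⟩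
  · have h := hx X
    have hr := congrArg cplxRe h
    have hi := congrArg cplxIm h
    rw [cplxRe_iMul_lie, cplxRe_smul] at hr
    rw [cplxIm_iMul_lie, cplxIm_smul] at hi
    simp only [Complex.ofReal_re, Complex.ofReal_im, zero_smul, sub_zero, add_zero] at hr hi
    apply Cplx.ext_re_im
    · rw [cplxRe_iMul_lie, cplxRe_smul, map_sub, map_sub, cplxIm_toCplx, cplxIm_iMul,
        cplxRe_toCplx, cplxRe_iMul]
      simp only [Complex.ofReal_re, Complex.ofReal_im, zero_smul, sub_zero, LinearMap.neg_apply,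
        zero_sub, lie_neg, neg_smul, ← hr, neg_neg]
    · rw [cplxIm_iMul_lie, cplxIm_smul, map_sub, map_sub, cplxIm_toCplx, cplxIm_iMul,
        cplxRe_toCplx, cplxRe_iMul]
      simp [hi]
  · have hr := congrArg cplxRe h
    have hi := congrArg cplxIm h
    rw [map_sub, cplxRe_toCplx, cplxRe_iMul, sub_zero] at hr
    rw [map_sub, cplxIm_toCplx, cplxIm_iMul, zero_sub, map_zero, neg_eq_zero] at hi
    exact Cplx.ext_re_im (by rw [hr]) (by rw [hi, map_zero])

theorem neg_mem_pos {α : C.Weight} (hα : α ∈ roots C.t) (hα' : α ∉ C.pos) : -α ∈ C.pos := by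
  obtain ⟨X, hX, hpos⟩ := C.pos_system
  rw [hpos] at hα' ⊢
  refine ⟨C.neg_mem_roots hα, ?_⟩
  have h : α X < 0 := lt_of_le_of_ne (not_lt.1 fun h => hα' ⟨hα, h⟩) (hX α hα)
  rwa [LinearMap.neg_apply, neg_pos]

/-- The involution `τ` maps the negative roots with non-zero restriction to positive roots. -/
theorem comp_tauT_mem_pos {α : C.Weight} (hα : α ∈ roots C.t) (hα' : α ∉ C.pos)
    (hres : α.comp (S.tq C.t).subtype ≠ 0) : α.comp C.tauT ∈ C.pos := by
  -- Since τ is -1 on 𝔱 ∩ 𝔮, the positive roots -(α ∘ τ) and -α would restrict to opposite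
  -- functionals on 𝔞, which a positive system of restricted roots excludes.
  by_contra hβ
  have hcomp : (α.comp C.tauT).comp (S.tq C.t).subtype = -α.comp (S.tq C.t).subtype := by
    ext X
    have h := C.tauT_of_mem_tq X.2
    simp [h]
  have hβroot : α.comp C.tauT ∈ roots C.t := by
    obtain ⟨h0, x, hx, hx0⟩ := hα
    refine ⟨fun h => hres ?_, _, C.tauC_mem_rootSpace hx, tauC_ne_zero hx0⟩
    rw [h, LinearMap.zero_comp] at hcomp
    rw [← neg_eq_zero, ← hcomp]
  obtain ⟨Y, -, hY⟩ := C.pos_restricted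
  have h1 : α.comp (S.tq C.t).subtype ∈ S.restrictedSet C.t C.pos := by
    refine ⟨⟨_, C.neg_mem_pos hβroot hβ, ?_⟩, hres⟩
    change (-(α.comp C.tauT)).comp (S.tq C.t).subtype = _
    rw [LinearMap.neg_comp, hcomp, neg_neg]
  have h2 : -α.comp (S.tq C.t).subtype ∈ S.restrictedSet C.t C.pos := by
    refine ⟨⟨_, C.neg_mem_pos hα hα', ?_⟩, neg_ne_zero.2 hres⟩
    change (-α).comp (S.tq C.t).subtype = _
    rw [LinearMap.neg_comp]
  rw [hY] at h1 h2
  have h3 := h1.2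
  have h4 := h2.2
  rw [LinearMap.neg_apply] at h4
  linarith

variable (S) in
/-- `𝔥_ℂ`, the complex span of `𝔥`. -/
def hC : Submodule ℂ (Cplx 𝔤) := Submodule.span ℂ (toCplx '' (S.h : Set 𝔤))

theorem mem_hC {x : Cplx 𝔤} (hr : cplxRe x ∈ S.h) (hi : cplxIm x ∈ S.h) : x ∈ hC S := by
  rw [← toCplx_cplxRe_add_iMul_cplxIm x, iMul_eq_smul_toCplx]
  exact Submodule.add_mem _ (Submodule.subset_span ⟨_, hr, rfl⟩)
    (Submodule.smul_mem _ _ (Submodule.subset_span ⟨_, hi, rfl⟩))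

theorem add_tau_mem_h (X : 𝔤) : X + S.τ X ∈ S.h := by
  change S.τ (X + S.τ X) = X + S.τ X
  rw [map_add, S.τ_invol, add_comm]

/-- An element of `𝔨` that commutes with `𝔱 ∩ 𝔮` is the sum of an element of `𝔥` and an element
of `𝔱`. -/
theorem sub_tau_mem_t {X : 𝔤} (hX : X ∈ S.k) (hcomm : ∀ T ∈ C.t, T ∈ S.q → ⁅T, X⁆ = 0) :
    X - S.τ X ∈ C.t := by
  refine C.tq_maximal _ ?_ ?_ fun T hT hTq => ?_
  · change S.τ (X - S.τ X) = -(X - S.τ X)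
    rw [map_sub, S.τ_invol, neg_sub]
  · change S.θ (X - S.τ X) = X - S.τ X
    have hX' : S.θ X = X := hX
    rw [map_sub, ← S.τ_θ, hX']
  · have hTq' : S.τ T = -T := hTq
    have h := congrArg S.τ (hcomm T hT hTq)
    rw [LieEquiv.map_lie, hTq', map_zero, neg_lie, neg_eq_zero] at h
    rw [← lie_skew, lie_sub, hcomm T hT hTq, h, sub_zero, neg_zero]

/-- An Iwasawa-type decomposition: modulo 𝔥_ℂ, a negative root vector can be exchanged for a
positive one by τ, or for an element of 𝔱_ℂ when its root vanishes on 𝔞. -/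
theorem exists_hC [FiniteDimensional ℝ 𝔤] [LieAlgebra.IsSimple ℝ 𝔤]
    (hS : S.IsCompactlyCausal) {V : Type*} [AddCommGroup V] [Module ℂ V]
    {ρ : Cplx 𝔤 →ₗ[ℂ] V} {v : V} {lam : C.Weight}
    (ht : ∀ X : C.t, ρ (iMul (X : 𝔤)) = (lam X : ℂ) • v)
    (hpos : ∀ α ∈ C.pos, ∀ x ∈ rootSpace C.t α, ρ x = 0) (x : Cplx 𝔤) :
    ∃ y ∈ hC S, ∃ c : ℂ, ρ (x - y) = c • v := by
  have hx : x ∈ Submodule.span ℂ {x : Cplx 𝔤 | ∃ α : C.Weight, x ∈ rootSpace C.t α} := by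
    rw [C.span_rootSpace_eq_top]; trivial
  induction hx using Submodule.span_induction with
  | mem x hx =>
    obtain ⟨α, hx⟩ := hx
    by_cases hx0 : x = 0
    · exact ⟨0, Submodule.zero_mem _, 0, by simp [hx0]⟩
    by_cases hα : α ∈ C.pos
    · exact ⟨0, Submodule.zero_mem _, 0, by rw [sub_zero, hpos α hα x hx, zero_smul]⟩
    -- Here x centralizes 𝔱 ∩ 𝔮, which contains Z by compact causality, so x lies in 𝔨_ℂ. Its
    -- τ-fixed half is in 𝔥_ℂ, and its τ-odd half is in 𝔱_ℂ by maximality of 𝔱 ∩ 𝔮.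
    by_cases hres : α.comp (S.tq C.t).subtype = 0
    · have hcomm : ∀ T ∈ C.t, T ∈ S.q → ⁅iMul T, x⁆ = 0 := fun T hT hTq => by
        have h : α ⟨T, hT⟩ = 0 := LinearMap.congr_fun hres ⟨⟨T, hT⟩, hTq⟩
        rw [hx ⟨T, hT⟩, h, Complex.ofReal_zero, zero_smul]
      have hr : ∀ T ∈ C.t, T ∈ S.q → ⁅T, cplxRe x⁆ = 0 := fun T hT hTq => by
        rw [← cplxIm_iMul_lie, hcomm T hT hTq, map_zero]
      have hi : ∀ T ∈ C.t, T ∈ S.q → ⁅T, cplxIm x⁆ = 0 := fun T hT hTq => by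
        rw [← neg_eq_zero, ← cplxRe_iMul_lie, hcomm T hT hTq, map_zero]
      have hZq := hS C.Z C.Z_center
      have htr := C.sub_tau_mem_t (C.mem_k_of_Z_lie_eq_zero (hr _ C.Zt.2 hZq)) hr
      have hti := C.sub_tau_mem_t (C.mem_k_of_Z_lie_eq_zero (hi _ C.Zt.2 hZq)) hi
      refine ⟨(2⁻¹ : ℂ) • (x + tauC S x), Submodule.smul_mem _ _ (mem_hC ?_ ?_), ?_⟩
      · rw [map_add, cplxRe_tauC]; exact add_tau_mem_h _
      · rw [map_add, cplxIm_tauC]; exact add_tau_mem_h _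
      · obtain ⟨c, hc⟩ := C.exists_smul_of_re_im_mem_t ht (x := x - tauC S x)
          ⟨by rwa [map_sub, cplxRe_tauC], by rwa [map_sub, cplxIm_tauC]⟩
        refine ⟨2⁻¹ * c, ?_⟩
        have h : x - (2⁻¹ : ℂ) • (x + tauC S x) = (2⁻¹ : ℂ) • (x - tauC S x) := by
          module
        rw [h, map_smul, hc, mul_smul]
    -- Write x = (x + τ x) - τ x, where τ x is a positive root vector.
    · have hα0 : α ≠ 0 := fun h => hres (by rw [h, LinearMap.zero_comp])
      refine ⟨x + tauC S x, mem_hC ?_ ?_, 0, ?_⟩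
      · rw [map_add, cplxRe_tauC]; exact add_tau_mem_h _
      · rw [map_add, cplxIm_tauC]; exact add_tau_mem_h _
      · rw [sub_add_cancel_left, map_neg,
          hpos _ (C.comp_tauT_mem_pos ⟨hα0, x, hx, hx0⟩ hα hres) _ (C.tauC_mem_rootSpace hx),
          neg_zero, zero_smul]
  | zero => exact ⟨0, Submodule.zero_mem _, 0, by simp⟩
  | add a b _ _ ha hb =>
    obtain ⟨y, hy, c, hc⟩ := ha
    obtain ⟨z, hz, d, hd⟩ := hb
    exact ⟨y + z, Submodule.add_mem _ hy hz, c + d, by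
      rw [add_sub_add_comm, map_add, hc, hd, add_smul]⟩
  | smul r a _ ha =>
    obtain ⟨y, hy, c, hc⟩ := ha
    exact ⟨r • y, Submodule.smul_mem _ _ hy, r * c, by rw [← smul_sub, map_smul, hc, mul_smul]⟩

end HermitianSymmetric.CartanData

/-! ### Modules over enveloping algebras -/

section Representations

variable {𝔩 V : Type*} [LieRing 𝔩] [LieAlgebra ℂ 𝔩] [AddCommGroup V] [Module ℂ V]

theorem IsCyclicVector.map {W : Type*} [AddCommGroup W] [Module ℂ W]
    {ρ : 𝔩 →ₗ[ℂ] Module.End ℂ V} {σ : 𝔩 →ₗ[ℂ] Module.End ℂ W} {v : V} (hv : IsCyclicVector ρ v)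
    {f : V →ₗ[ℂ] W} (hf : Function.Surjective f) (hfρ : ∀ x u, f (ρ x u) = σ x (f u)) :
    IsCyclicVector σ (f v) := by
  intro Q hQ hstable
  have h : Q.comap f = ⊤ := hv _ hQ fun x u hu => by
    change f (ρ x u) ∈ Q
    rw [hfρ]
    exact hstable x _ hu
  rw [eq_top_iff]
  intro w _
  obtain ⟨u, rfl⟩ := hf w
  have hu : u ∈ Q.comap f := by rw [h]; trivial
  exact hu

theorem IsCyclicVector.ne_zero {ρ : 𝔩 →ₗ[ℂ] Module.End ℂ V} {v : V} (hv : IsCyclicVector ρ v)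
    [Nontrivial V] : v ≠ 0 := by
  rintro rfl
  refine bot_ne_top (hv ⊥ (Submodule.zero_mem _) fun x u hu => ?_)
  rw [(Submodule.mem_bot ℂ).1 hu, map_zero]
  exact Submodule.zero_mem _

attribute [local instance] LieRing.ofAssociativeRing LieAlgebra.ofAssociativeAlgebra

/-- An element of the enveloping algebra belongs to every subalgebra that contains the Lie
algebra. -/
theorem UniversalEnvelopingAlgebra.mem_of_forall_ι_mem
    (A : Subalgebra ℂ (UniversalEnvelopingAlgebra ℂ 𝔩))
    (hA : ∀ x : 𝔩, UniversalEnvelopingAlgebra.ι ℂ x ∈ A) (u : UniversalEnvelopingAlgebra ℂ 𝔩) :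
    u ∈ A := by
  let j : 𝔩 →ₗ⁅ℂ⁆ A :=
    { toFun := fun x => ⟨UniversalEnvelopingAlgebra.ι ℂ x, hA x⟩
      map_add' := fun x y => Subtype.ext (map_add _ x y)
      map_smul' := fun c x => Subtype.ext (map_smul _ c x)
      map_lie' := fun {x y} => Subtype.ext (LieHom.map_lie _ x y) }
  -- The lift of `j` followed by the inclusion of A fixes the generators, hence is the identity.
  have h : A.val.comp (UniversalEnvelopingAlgebra.lift ℂ j) = AlgHom.id ℂ _ := by
    refine UniversalEnvelopingAlgebra.hom_ext ℂ (LieHom.ext fun x => ?_)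
    change ((UniversalEnvelopingAlgebra.lift ℂ j (UniversalEnvelopingAlgebra.ι ℂ x) : A) :
      UniversalEnvelopingAlgebra ℂ 𝔩) = UniversalEnvelopingAlgebra.ι ℂ x
    rw [UniversalEnvelopingAlgebra.lift_ι_apply]
    rfl
  have hu := AlgHom.congr_fun h u
  change ((UniversalEnvelopingAlgebra.lift ℂ j u : A) : UniversalEnvelopingAlgebra ℂ 𝔩) = u at hu
  rw [← hu]
  exact Subtype.property _

variable (𝔩 V) in
/-- The representation of `𝔩` on a module over its enveloping algebra. -/
def envelopingRep [Module (UniversalEnvelopingAlgebra ℂ 𝔩) V]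
    [IsScalarTower ℂ (UniversalEnvelopingAlgebra ℂ 𝔩) V] : 𝔩 →ₗ[ℂ] Module.End ℂ V :=
  (Algebra.lsmul ℂ ℂ V : UniversalEnvelopingAlgebra ℂ 𝔩 →ₐ[ℂ] Module.End ℂ V).toLinearMap ∘ₗ
    (UniversalEnvelopingAlgebra.ι ℂ : 𝔩 →ₗ⁅ℂ⁆ UniversalEnvelopingAlgebra ℂ 𝔩).toLinearMap

variable [Module (UniversalEnvelopingAlgebra ℂ 𝔩) V]
  [IsScalarTower ℂ (UniversalEnvelopingAlgebra ℂ 𝔩) V]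

theorem envelopingRep_apply (x : 𝔩) (v : V) :
    envelopingRep 𝔩 V x v = UniversalEnvelopingAlgebra.ι ℂ x • v := rfl

theorem envelopingRep_lie (x y : 𝔩) (v : V) :
    envelopingRep 𝔩 V ⁅x, y⁆ v = envelopingRep 𝔩 V x (envelopingRep 𝔩 V y v) -
      envelopingRep 𝔩 V y (envelopingRep 𝔩 V x v) := by
  simp only [envelopingRep_apply]
  rw [LieHom.map_lie, LieRing.of_associative_ring_bracket, sub_smul, mul_smul, mul_smul]

theorem smul_mem_of_envelopingRep_stable {Q : Submodule ℂ V}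
    (hQ : ∀ x, ∀ u ∈ Q, envelopingRep 𝔩 V x u ∈ Q) (u : UniversalEnvelopingAlgebra ℂ 𝔩) {v : V}
    (hv : v ∈ Q) : u • v ∈ Q := by
  let A : Subalgebra ℂ (UniversalEnvelopingAlgebra ℂ 𝔩) :=
    { carrier := {u | ∀ v ∈ Q, u • v ∈ Q}
      mul_mem' := fun {a b} ha hb v hv => by rw [mul_smul]; exact ha _ (hb v hv)
      add_mem' := fun {a b} ha hb v hv => by rw [add_smul]; exact Q.add_mem (ha v hv) (hb v hv)
      algebraMap_mem' := fun c v hv => by rw [algebraMap_smul]; exact Q.smul_mem c hv }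
  exact UniversalEnvelopingAlgebra.mem_of_forall_ι_mem A (fun x v hv => hQ x v hv) u v hv

theorem isCyclicVector_envelopingRep {v : V}
    (hv : ∀ w : V, ∃ u : UniversalEnvelopingAlgebra ℂ 𝔩, w = u • v) :
    IsCyclicVector (envelopingRep 𝔩 V) v := by
  intro Q hvQ hQ
  rw [eq_top_iff]
  intro w _
  obtain ⟨u, rfl⟩ := hv w
  exact smul_mem_of_envelopingRep_stable hQ u hvQ

/-- A semilinear map of modules along an algebra homomorphism to the endomorphisms of `M` is
complex linear. -/
def complexLinearOfSemilinear {M : Type*} [AddCommGroup M] [Module ℂ M]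
    {π : UniversalEnvelopingAlgebra ℂ 𝔩 →ₐ[ℂ] Module.End ℂ M}
    (f : V →ₛₗ[(π : UniversalEnvelopingAlgebra ℂ 𝔩 →+* Module.End ℂ M)] M) : V →ₗ[ℂ] M where
  toFun := f
  map_add' := map_add f
  map_smul' c v := by
    rw [← algebraMap_smul (UniversalEnvelopingAlgebra ℂ 𝔩) c v, LinearMap.map_smulₛₗ]
    change π (algebraMap ℂ _ c) • f v = c • f v
    rw [AlgHom.commutes]
    rfl

end Representations

theorem le_sumOfProperSubmodules {R M : Type*} [Ring R] [AddCommGroup M] [Module R M]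
    {Q : Submodule R M} (hQ : Q ≠ ⊤) : Q ≤ sumOfProperSubmodules R M := le_sSup hQ

/-! ### The modules F(λ), N(λ), L(λ) and the recognition of L(λ) -/

namespace HermitianSymmetric.CartanData

attribute [local instance] LieRing.ofAssociativeRing LieAlgebra.ofAssociativeAlgebra

open UniversalEnvelopingAlgebra (ι)

variable {𝔤 : Type u} [LieRing 𝔤] [LieAlgebra ℝ 𝔤] {S : HermitianSymmetric 𝔤} (C : S.CartanData)

/-- The canonical generator of the Verma module. -/
def vermaVector (lam : C.Weight) : C.VermaK lam := (C.vermaIdeal lam).mkQ 1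

theorem smul_vermaVector (lam : C.Weight) (u : UniversalEnvelopingAlgebra ℂ S.kC) :
    u • C.vermaVector lam = (C.vermaIdeal lam).mkQ u := by
  have h := (map_smul (C.vermaIdeal lam).mkQ u 1).symm
  rw [smul_eq_mul, mul_one] at h
  exact h

theorem isCyclicVector_vermaVector (lam : C.Weight) :
    IsCyclicVector (envelopingRep S.kC (C.VermaK lam)) (C.vermaVector lam) :=
  isCyclicVector_envelopingRep fun w => by
    obtain ⟨u, rfl⟩ := (C.vermaIdeal lam).mkQ_surjective w
    exact ⟨u, (C.smul_vermaVector lam u).symm⟩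

theorem ι_smul_vermaVector_of_compactPos (lam : C.Weight) {α : C.Weight} (hα : α ∈ C.compactPos)
    {x : S.kC} (hx : (x : Cplx 𝔤) ∈ rootSpace C.t α) : ι ℂ x • C.vermaVector lam = 0 := by
  rw [smul_vermaVector]
  exact (Submodule.Quotient.mk_eq_zero _).2 (Submodule.subset_span (Or.inl ⟨α, hα, x, hx, rfl⟩))

theorem ι_smul_vermaVector_of_mem_t (lam : C.Weight) (X : C.t) {x : S.kC}
    (hx : (x : Cplx 𝔤) = iMul (X : 𝔤)) :
    ι ℂ x • C.vermaVector lam = (lam X : ℂ) • C.vermaVector lam := by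
  rw [← algebraMap_smul (UniversalEnvelopingAlgebra ℂ S.kC) (lam X : ℂ), smul_vermaVector,
    smul_vermaVector]
  exact (Submodule.Quotient.eq _).2 (Submodule.subset_span (Or.inr ⟨X, x, hx, rfl⟩))

/-- The projection from the Verma module to `F(λ)`. -/
def vermaToF (lam : C.Weight) : C.VermaK lam →ₗ[UniversalEnvelopingAlgebra ℂ S.kC] C.F lam :=
  (sumOfProperSubmodules (UniversalEnvelopingAlgebra ℂ S.kC) (C.VermaK lam)).mkQ

theorem vermaToF_surjective (lam : C.Weight) : Function.Surjective (C.vermaToF lam) :=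
  Submodule.mkQ_surjective _

theorem isCyclicVector_vermaToF (lam : C.Weight) :
    IsCyclicVector (envelopingRep S.kC (C.F lam)) (C.vermaToF lam (C.vermaVector lam)) :=
  (C.isCyclicVector_vermaVector lam).map (f := (C.vermaToF lam).restrictScalars ℂ)
    (C.vermaToF_surjective lam) fun _ _ => map_smul (C.vermaToF lam) _ _

/-- The projection from `U(𝔤_ℂ) ⊗ F(λ)` to `N(λ)`. -/
def toN (lam : C.Weight) :
    UniversalEnvelopingAlgebra ℂ (Cplx 𝔤) ⊗[ℂ] C.F lam
      →ₗ[UniversalEnvelopingAlgebra ℂ (Cplx 𝔤)] C.N lam :=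
  (C.inducedRel lam).mkQ

/-- The embedding of `F(λ)` in `N(λ)`. -/
def FToN (lam : C.Weight) : C.F lam →ₗ[ℂ] C.N lam :=
  (C.toN lam).restrictScalars ℂ ∘ₗ TensorProduct.mk ℂ _ _ 1

theorem toN_tmul (lam : C.Weight) (u : UniversalEnvelopingAlgebra ℂ (Cplx 𝔤)) (f : C.F lam) :
    C.toN lam (u ⊗ₜ f) = u • C.FToN lam f := by
  have h : u ⊗ₜ[ℂ] f = u • ((1 : UniversalEnvelopingAlgebra ℂ (Cplx 𝔤)) ⊗ₜ[ℂ] f) := by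
    rw [TensorProduct.smul_tmul', smul_eq_mul, mul_one]
  rw [h, map_smul]
  rfl

theorem ι_smul_FToN (lam : C.Weight) (x : S.kC) (f : C.F lam) :
    ι ℂ (x : Cplx 𝔤) • C.FToN lam f = C.FToN lam (ι ℂ x • f) := by
  rw [← toN_tmul]
  refine (Submodule.Quotient.eq _).2 (Submodule.subset_span (Or.inl ⟨1, x, f, ?_⟩))
  rw [one_mul]
  rfl

theorem ι_smul_FToN_of_Z₀_lie_eq (lam : C.Weight) {x : Cplx 𝔤} (hx : ⁅C.Z₀, x⁆ = x)
    (f : C.F lam) : ι ℂ x • C.FToN lam f = 0 := by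
  rw [← toN_tmul]
  refine (Submodule.Quotient.mk_eq_zero _).2 (Submodule.subset_span (Or.inr ⟨1, x, f, hx, ?_⟩))
  rw [one_mul]

/-- The canonical generator of `N(λ)`. -/
def NVector (lam : C.Weight) : C.N lam := C.FToN lam (C.vermaToF lam (C.vermaVector lam))

/-- 𝔨_ℂ generates F(λ) from its highest weight vector, and U(𝔤_ℂ) generates N(λ) from F(λ). -/
theorem isCyclicVector_NVector (lam : C.Weight) :
    IsCyclicVector (envelopingRep (Cplx 𝔤) (C.N lam)) (C.NVector lam) := by
  intro Q hvQ hQ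
  have hF : Q.comap (C.FToN lam) = ⊤ :=
    C.isCyclicVector_vermaToF lam _ hvQ fun x f hf => by
      change C.FToN lam (ι ℂ x • f) ∈ Q
      rw [← ι_smul_FToN]
      exact hQ _ _ hf
  have hall : ∀ t, C.toN lam t ∈ Q := by
    intro t
    induction t using TensorProduct.induction_on with
    | zero => rw [map_zero]; exact Q.zero_mem
    | tmul u f =>
      have hf : f ∈ Q.comap (C.FToN lam) := by rw [hF]; trivial
      rw [toN_tmul]
      exact smul_mem_of_envelopingRep_stable hQ u hf
    | add a b ha hb => rw [map_add]; exact Q.add_mem ha hb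
  rw [eq_top_iff]
  intro w _
  obtain ⟨t, rfl⟩ := (C.inducedRel lam).mkQ_surjective w
  exact hall t

theorem ι_smul_NVector_of_mem_t (lam : C.Weight) (X : C.t) :
    ι ℂ (iMul (X : 𝔤)) • C.NVector lam = (lam X : ℂ) • C.NVector lam := by
  have h := C.ι_smul_FToN lam ⟨iMul (X : 𝔤), S.iMul_mem_kC (C.t_le X.2)⟩
    (C.vermaToF lam (C.vermaVector lam))
  rw [← map_smul (C.vermaToF lam), C.ι_smul_vermaVector_of_mem_t lam X
      (x := ⟨iMul (X : 𝔤), S.iMul_mem_kC (C.t_le X.2)⟩) rfl, LinearMap.map_smul_of_tower, map_smul] at h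
  exact h

/-- Compact positive root vectors already kill the generator of F(λ); non-compact ones lie in 𝔭⁺,
which acts by zero on F(λ). -/
theorem ι_smul_NVector_of_pos [FiniteDimensional ℝ 𝔤] [LieAlgebra.IsSimple ℝ 𝔤] (lam : C.Weight)
    {α : C.Weight} (hα : α ∈ C.pos) {x : Cplx 𝔤} (hx : x ∈ rootSpace C.t α) :
    ι ℂ x • C.NVector lam = 0 := by
  by_cases h0 : α C.Zt = 0
  · have hxk : x ∈ S.kC := C.mem_kC_iff_Z₀_lie_eq_zero.2 (by
      rw [C.Z₀_lie_eq hx, h0, Complex.ofReal_zero, zero_smul])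
    have h := C.ι_smul_FToN lam ⟨x, hxk⟩ (C.vermaToF lam (C.vermaVector lam))
    rw [← map_smul (C.vermaToF lam), C.ι_smul_vermaVector_of_compactPos lam (x := ⟨x, hxk⟩) ⟨hα, h0⟩ hx, map_zero,
      map_zero] at h
    exact h
  · obtain ⟨X, -, hroots⟩ := C.exists_regular
    have h1 : α C.Zt = 1 := (C.pos_noncompact α (hroots α hα) h0).1 hα
    exact C.ι_smul_FToN_of_Z₀_lie_eq lam
      (by rw [C.Z₀_lie_eq hx, h1, Complex.ofReal_one, one_smul]) _

/-- The projection from `N(λ)` to `L(λ)`. -/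
def NToL (lam : C.Weight) : C.N lam →ₗ[UniversalEnvelopingAlgebra ℂ (Cplx 𝔤)] C.L lam :=
  (C.J lam).mkQ

theorem NToL_surjective (lam : C.Weight) : Function.Surjective (C.NToL lam) :=
  Submodule.mkQ_surjective _

theorem NToL_eq_zero_iff {lam : C.Weight} {n : C.N lam} : C.NToL lam n = 0 ↔ n ∈ C.J lam :=
  Submodule.Quotient.mk_eq_zero _

theorem isCyclicVector_NToL (lam : C.Weight) :
    IsCyclicVector (envelopingRep (Cplx 𝔤) (C.L lam)) (C.NToL lam (C.NVector lam)) :=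
  (C.isCyclicVector_NVector lam).map (f := (C.NToL lam).restrictScalars ℂ)
    (C.NToL_surjective lam) fun _ _ => map_smul (C.NToL lam) _ _

theorem exists_isHighestWeightVector [FiniteDimensional ℝ 𝔤] [LieAlgebra.IsSimple ℝ 𝔤]
    (lam : C.Weight) [Nontrivial (C.L lam)] : ∃ v : C.L lam, C.IsHighestWeightVector lam v := by
  refine ⟨C.NToL lam (C.NVector lam), (C.isCyclicVector_NToL lam).ne_zero, fun X => ?_,
    fun α hα x hx => ?_⟩
  · change ι ℂ (iMul (X : 𝔤)) • C.NToL lam (C.NVector lam) = _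
    rw [← map_smul, C.ι_smul_NVector_of_mem_t, LinearMap.map_smul_of_tower]
  · change ι ℂ x • C.NToL lam (C.NVector lam) = _
    rw [← map_smul, C.ι_smul_NVector_of_pos lam hα hx, map_zero]

/-- The module `L(λ)` is simple: every non-zero vector is cyclic. -/
theorem isCyclicVector_of_ne_zero {lam : C.Weight} {v : C.L lam} (hv : v ≠ 0) :
    IsCyclicVector (envelopingRep (Cplx 𝔤) (C.L lam)) v := by
  intro Q hvQ hQ
  let Q' : Submodule (UniversalEnvelopingAlgebra ℂ (Cplx 𝔤)) (C.N lam) :=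
    { carrier := {n | C.NToL lam n ∈ Q}
      zero_mem' := by change C.NToL lam 0 ∈ Q; rw [map_zero]; exact Q.zero_mem
      add_mem' := fun {a b} ha hb => by
        change C.NToL lam (a + b) ∈ Q
        rw [map_add]
        exact Q.add_mem ha hb
      smul_mem' := fun u a ha => by
        change C.NToL lam (u • a) ∈ Q
        rw [map_smul]
        exact smul_mem_of_envelopingRep_stable hQ u ha }
  -- A proper preimage would lie in J(λ), and v would be zero.
  have hQ' : Q' = ⊤ := by
    by_contra hne
    obtain ⟨n, rfl⟩ := C.NToL_surjective lam v
    exact hv (C.NToL_eq_zero_iff.2 (le_sumOfProperSubmodules hne hvQ))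
  rw [eq_top_iff]
  intro w _
  obtain ⟨n, rfl⟩ := C.NToL_surjective lam w
  have hn : n ∈ Q' := by rw [hQ']; trivial
  exact hn

/-- A spherical functional does not vanish at a highest weight vector. -/
theorem sphericalFunctional_apply_ne_zero [FiniteDimensional ℝ 𝔤] [LieAlgebra.IsSimple ℝ 𝔤]
    (hS : S.IsCompactlyCausal) {lam : C.Weight} {v : C.L lam} (hv : C.IsHighestWeightVector lam v)
    {ν : C.L lam →ₛₗ[starRingEnd ℂ] ℂ} (hν : S.IsSphericalFunctional ν) : ν v ≠ 0 := by
  intro h0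
  have htop : LinearMap.ker ν = ⊤ := by
    -- The word filtration is used with n = 𝔥_ℂ, whose elements send every vector into the kernel of
    -- ν.
    refine (C.isCyclicVector_of_ne_zero hv.1).eq_top_of_stable envelopingRep_lie
      (C.exists_hC hS (ρ := (envelopingRep (Cplx 𝔤) (C.L lam)).flip v) (lam := lam)
        hv.2.1 hv.2.2) h0 ?_
    intro y hy u _
    change ν ⁅y, u⁆ = 0
    change y ∈ Submodule.span ℂ (toCplx '' (S.h : Set 𝔤)) at hy
    induction hy using Submodule.span_induction with
    | mem y hy =>
      obtain ⟨X, hX, rfl⟩ := hy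
      exact hν.2 X hX u
    | zero => rw [zero_lie, map_zero]
    | add a b _ _ ha hb => rw [add_lie, map_add, ha, hb, add_zero]
    | smul c a _ ha => rw [smul_lie, LinearMap.map_smulₛₗ, ha, smul_zero]
  exact hν.1 (LinearMap.ker_eq_top.1 htop)

/-- A unitarizable module generated by a highest weight vector of weight `λ` is isomorphic to
`L(λ)`. -/
theorem nonempty_lieEquiv_L [FiniteDimensional ℝ 𝔤] [LieAlgebra.IsSimple ℝ 𝔤] (lam : C.Weight)
    {M : Type*} [AddCommGroup M] [Module ℂ M] [LieRingModule (Cplx 𝔤) M] [LieModule ℂ (Cplx 𝔤) M]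
    (hM : IsUnitarizable (𝔤 := 𝔤) M) {m : M} (hm : C.IsHighestWeightVector lam m)
    (hgen : ∀ Q : LieSubmodule ℂ (Cplx 𝔤) M, m ∈ Q → Q = ⊤) :
    Nonempty (C.L lam ≃ₗ⁅ℂ, Cplx 𝔤⁆ M) := by
  obtain ⟨B, -, hBpos, hB⟩ := hM
  obtain ⟨X₀, hX₀, -⟩ := C.exists_regular
  -- M stays a module over its own endomorphism ring. Maps semilinear along π and `πk` play the role
  -- of U-linear maps, so that no U-module structures are put on M.
  let π : UniversalEnvelopingAlgebra ℂ (Cplx 𝔤) →ₐ[ℂ] Module.End ℂ M :=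
    UniversalEnvelopingAlgebra.lift ℂ (LieModule.toEnd ℂ (Cplx 𝔤) M)
  let πk : UniversalEnvelopingAlgebra ℂ S.kC →ₐ[ℂ] Module.End ℂ M :=
    UniversalEnvelopingAlgebra.lift ℂ ((LieModule.toEnd ℂ (Cplx 𝔤) M).comp S.kC.incl)
  have hπ : ∀ x n, π (ι ℂ x) n = ⁅x, n⁆ := fun x n => by
    simp only [π, UniversalEnvelopingAlgebra.lift_ι_apply]; rfl
  have hπk : ∀ (x : S.kC) n, πk (ι ℂ x) n = ⁅(x : Cplx 𝔤), n⁆ := fun x n => by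
    simp only [πk, UniversalEnvelopingAlgebra.lift_ι_apply]; rfl
  -- the map from the Verma module
  let f₀ : UniversalEnvelopingAlgebra ℂ S.kC
      →ₛₗ[(πk : UniversalEnvelopingAlgebra ℂ S.kC →+* Module.End ℂ M)] M :=
    { toFun := fun u => πk u m
      map_add' := fun a b => by rw [map_add, LinearMap.add_apply]
      map_smul' := fun a b => by rw [smul_eq_mul, map_mul]; rfl }
  have hf₀ : C.vermaIdeal lam ≤ LinearMap.ker f₀ := by
    refine Submodule.span_le.2 ?_
    rintro _ (⟨α, hα, x, hx, rfl⟩ | ⟨X, x, hx, rfl⟩)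
    · change πk (ι ℂ x) m = 0
      rw [hπk]
      exact hm.2.2 α hα.1 _ hx
    · change πk (ι ℂ x - algebraMap ℂ _ (lam X : ℂ)) m = 0
      rw [map_sub, LinearMap.sub_apply, hπk, hx, hm.2.1, AlgHom.commutes, sub_eq_zero]
      rfl
  let f₁ : C.VermaK lam →ₛₗ[(πk : UniversalEnvelopingAlgebra ℂ S.kC →+* Module.End ℂ M)] M :=
    (C.vermaIdeal lam).liftQ f₀ hf₀
  have hf₁ : f₁ (C.vermaVector lam) = m := by
    change πk 1 m = m
    rw [map_one]
    rfl
  -- The star preserves 𝔨_ℂ, so the form on M is also contravariant for 𝔨_ℂ and the orthogonality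
  -- argument applies there.
  have hf₁' : sumOfProperSubmodules (UniversalEnvelopingAlgebra ℂ S.kC) (C.VermaK lam) ≤
      LinearMap.ker f₁ := by
    refine sSup_le fun Q hQ q hq => ?_
    refine (C.isCyclicVector_vermaVector lam).map_eq_zero_of_ne_top envelopingRep_lie
      (H := ⟨iMul (X₀ : 𝔤), S.iMul_mem_kC (C.t_le X₀.2)⟩) (r := lam X₀)
      (C.ι_smul_vermaVector_of_mem_t lam X₀ rfl)
      (C.exists_negativePart_kC
        (ρ := (envelopingRep S.kC (C.VermaK lam)).flip (C.vermaVector lam)) (lam := lam)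
        (fun X => C.ι_smul_vermaVector_of_mem_t lam X rfl)
        (fun α hα x hx => C.ι_smul_vermaVector_of_compactPos lam hα hx) hX₀ rfl)
      (σ := fun x => LieModule.toEnd ℂ (Cplx 𝔤) M (x : Cplx 𝔤))
      (star := fun x => ⟨cplxStar (x : Cplx 𝔤), S.cplxStar_mem_kC x.2⟩)
      (Subtype.ext (cplxStar_iMul _)) hBpos (fun x a b => hB _ _ _)
      (φ := complexLinearOfSemilinear f₁) (fun x u => ?_)
      (Q := Q.restrictScalars ℂ) (fun x u hu => Q.smul_mem _ hu) (fun h => hQ ?_) hq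
    · change f₁ (ι ℂ x • u) = ⁅(x : Cplx 𝔤), f₁ u⁆
      rw [LinearMap.map_smulₛₗ, ← hπk]
      rfl
    · exact (Submodule.restrictScalars_eq_top_iff ℂ _ _).1 h
  let f₂ : C.F lam →ₛₗ[(πk : UniversalEnvelopingAlgebra ℂ S.kC →+* Module.End ℂ M)] M :=
    (sumOfProperSubmodules (UniversalEnvelopingAlgebra ℂ S.kC) (C.VermaK lam)).liftQ f₁ hf₁'
  have hf₂ : f₂ (C.vermaToF lam (C.vermaVector lam)) = m := hf₁
  have hf₂k : ∀ (x : S.kC) f, f₂ (ι ℂ x • f) = ⁅(x : Cplx 𝔤), f₂ f⁆ := fun x f => by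
    rw [LinearMap.map_smulₛₗ, ← hπk]
    rfl
  -- The vectors sent to 𝔭⁺-invariants of M. It contains the generator and is 𝔨_ℂ-stable because
  -- [𝔭⁺, 𝔨_ℂ] ⊆ 𝔭⁺; being all of F(λ), it makes the second family of induced relations hold in M.
  let K : Submodule ℂ (C.F lam) :=
    { carrier := {f | ∀ x : Cplx 𝔤, ⁅C.Z₀, x⁆ = x → ⁅x, f₂ f⁆ = 0}
      zero_mem' := fun x _ => by rw [map_zero, lie_zero]
      add_mem' := fun {a b} ha hb x hx => by rw [map_add, lie_add, ha x hx, hb x hx, add_zero]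
      smul_mem' := fun c a ha x hx => by
        change ⁅x, complexLinearOfSemilinear f₂ (c • a)⁆ = 0
        rw [map_smul, lie_smul]
        exact (congrArg (c • ·) (ha x hx)).trans (smul_zero c) }
  have hK : K = ⊤ := by
    refine C.isCyclicVector_vermaToF lam K (fun x hx => ?_) fun y f hf x hx => ?_
    · rw [hf₂]
      exact C.apply_eq_zero_of_Z₀_lie_eq (ρ := (LieModule.toEnd ℂ (Cplx 𝔤) M).toLinearMap.flip m)
        hm.2.2 hx
    · have hy : ⁅C.Z₀, (y : Cplx 𝔤)⁆ = 0 := C.mem_kC_iff_Z₀_lie_eq_zero.1 y.2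
      have h1 := hf ⁅x, (y : Cplx 𝔤)⁆ (by rw [leibniz_lie, hx, hy, lie_zero, add_zero])
      change ⁅x, f₂ (ι ℂ y • f)⁆ = 0
      rw [hf₂k, leibniz_lie, h1, hf x hx, lie_zero, add_zero]
  -- the map from `U(𝔤_ℂ) ⊗ F(λ)`
  let g₀ : UniversalEnvelopingAlgebra ℂ (Cplx 𝔤) ⊗[ℂ] C.F lam →ₗ[ℂ] M :=
    TensorProduct.lift ((LinearMap.lcomp ℂ M (complexLinearOfSemilinear f₂)) ∘ₗ π.toLinearMap)
  have hg₀ : ∀ u f, g₀ (u ⊗ₜ f) = π u (f₂ f) := fun u f => rfl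
  let g₁ : UniversalEnvelopingAlgebra ℂ (Cplx 𝔤) ⊗[ℂ] C.F lam
      →ₛₗ[(π : UniversalEnvelopingAlgebra ℂ (Cplx 𝔤) →+* Module.End ℂ M)] M :=
    { toFun := g₀
      map_add' := map_add g₀
      map_smul' := fun u t => by
        change g₀ (u • t) = π u (g₀ t)
        induction t using TensorProduct.induction_on with
        | zero => rw [smul_zero, map_zero, map_zero]
        | tmul w f =>
          rw [TensorProduct.smul_tmul', hg₀, hg₀, smul_eq_mul, map_mul, Module.End.mul_apply]
        | add a b ha hb => rw [smul_add, map_add, ha, hb, map_add, map_add] }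
  have hg₁ : C.inducedRel lam ≤ LinearMap.ker g₁ := by
    refine Submodule.span_le.2 ?_
    rintro _ (⟨u, x, f, rfl⟩ | ⟨u, x, f, hx, rfl⟩)
    · change g₀ (_ - _) = 0
      rw [map_sub, hg₀, hg₀, map_mul, Module.End.mul_apply, LinearMap.map_smulₛₗ, sub_eq_zero, hπ]
      change _ = π u (πk (ι ℂ x) (f₂ f))
      rw [hπk]
    · change g₀ _ = 0
      rw [hg₀, map_mul, Module.End.mul_apply, hπ]
      have hf : f ∈ K := by rw [hK]; trivial
      rw [hf x hx, map_zero]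
  let g₂ : C.N lam →ₛₗ[(π : UniversalEnvelopingAlgebra ℂ (Cplx 𝔤) →+* Module.End ℂ M)] M :=
    (C.inducedRel lam).liftQ g₁ hg₁
  have hg₂ : g₂ (C.NVector lam) = m := by
    change π 1 (f₂ (C.vermaToF lam (C.vermaVector lam))) = m
    rw [hf₂, map_one]
    rfl
  have hg₂' : C.J lam ≤ LinearMap.ker g₂ := by
    refine sSup_le fun Q hQ q hq => ?_
    refine (C.isCyclicVector_NVector lam).map_eq_zero_of_ne_top envelopingRep_lie
      (H := iMul (X₀ : 𝔤)) (r := lam X₀) (C.ι_smul_NVector_of_mem_t lam X₀)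
      (C.exists_negativePart
        (ρ := (envelopingRep (Cplx 𝔤) (C.N lam)).flip (C.NVector lam)) (lam := lam)
        (fun X => C.ι_smul_NVector_of_mem_t lam X)
        (fun α hα x hx => C.ι_smul_NVector_of_pos lam hα hx) hX₀)
      (σ := fun x => LieModule.toEnd ℂ (Cplx 𝔤) M x) (star := cplxStar)
      (cplxStar_iMul _) hBpos (fun x a b => hB _ _ _)
      (φ := complexLinearOfSemilinear g₂) (fun x u => ?_)
      (Q := Q.restrictScalars ℂ) (fun x u hu => Q.smul_mem _ hu) (fun h => hQ ?_) hq
    · change g₂ (ι ℂ x • u) = ⁅x, g₂ u⁆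
      rw [LinearMap.map_smulₛₗ, ← hπ]
      rfl
    · exact (Submodule.restrictScalars_eq_top_iff ℂ _ _).1 h
  let g₃ : C.L lam →ₛₗ[(π : UniversalEnvelopingAlgebra ℂ (Cplx 𝔤) →+* Module.End ℂ M)] M :=
    (C.J lam).liftQ g₂ hg₂'
  have hg₃ : ∀ n, g₃ (C.NToL lam n) = g₂ n := fun n => rfl
  -- The generator goes to m ≠ 0, so the kernel is a proper submodule; this gives injectivity on
  -- L(λ).
  have hker : LinearMap.ker g₂ ≤ C.J lam := by
    refine le_sumOfProperSubmodules fun htop => hm.1 ?_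
    have h : C.NVector lam ∈ LinearMap.ker g₂ := by rw [htop]; trivial
    rw [← hg₂]
    exact h
  let e : C.L lam →ₗ⁅ℂ, Cplx 𝔤⁆ M :=
    { complexLinearOfSemilinear g₃ with
      map_lie' := fun {x u} => by
        change g₃ (ι ℂ x • u) = ⁅x, g₃ u⁆
        rw [LinearMap.map_smulₛₗ, ← hπ]
        rfl }
  have hinj : Function.Injective e := by
    refine (injective_iff_map_eq_zero e).2 fun x hx => ?_
    obtain ⟨n, rfl⟩ := C.NToL_surjective lam x
    exact C.NToL_eq_zero_iff.2 (hker hx)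
  have hsurj : Function.Surjective e := by
    refine (LieModuleHom.range_eq_top e).1 (hgen _ ?_)
    exact (LieModuleHom.mem_range e m).2 ⟨C.NToL lam (C.NVector lam), hg₂⟩
  let e' := LinearEquiv.ofBijective (e : C.L lam →ₗ[ℂ] M) ⟨hinj, hsurj⟩
  exact ⟨{ e with
    invFun := e'.symm
    left_inv := e'.left_inv
    right_inv := e'.right_inv }⟩

end HermitianSymmetric.CartanData

/-! ### Unitarity of submodules and tensor products -/

section Unitarizable

variable {𝔤 : Type u} [LieRing 𝔤] [LieAlgebra ℝ 𝔤] {V W : Type*}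
  [AddCommGroup V] [Module ℂ V] [LieRingModule (Cplx 𝔤) V]
  [AddCommGroup W] [Module ℂ W] [LieRingModule (Cplx 𝔤) W]

theorem IsUnitarizable.of_injective (hW : IsUnitarizable (𝔤 := 𝔤) W) (f : V →ₗ⁅ℂ, Cplx 𝔤⁆ W)
    (hf : Function.Injective f) : IsUnitarizable (𝔤 := 𝔤) V := by
  obtain ⟨B, hsymm, hpos, hB⟩ := hW
  refine ⟨LinearMap.mk₂'ₛₗ (starRingEnd ℂ) (RingHom.id ℂ) (fun v w => B (f v) (f w))
    (fun v v' w => by simp) (fun c v w => by simp) (fun v w w' => by simp)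
    (fun c v w => by simp), fun v w => hsymm _ _, fun v hv => hpos _ ?_, fun X v w => ?_⟩
  · exact fun h => hv (hf (by rw [h, map_zero]))
  · change B (f ⁅X, v⁆) (f w) = B (f v) (f ⁅cplxStar X, w⁆)
    rw [LieModuleHom.map_lie, LieModuleHom.map_lie, hB]

theorem IsUnitarizable.tensorProduct [LieModule ℂ (Cplx 𝔤) V] [LieModule ℂ (Cplx 𝔤) W]
    (hV : IsUnitarizable (𝔤 := 𝔤) V) (hW : IsUnitarizable (𝔤 := 𝔤) W) :
    IsUnitarizable (𝔤 := 𝔤) (V ⊗[ℂ] W) := by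
  obtain ⟨B, hsymm, hpos, hB⟩ := hV
  obtain ⟨B', hsymm', hpos', hB'⟩ := hW
  obtain ⟨D, hDsymm, hDpos, hD⟩ := exists_tensor_form B hsymm hpos B' hsymm' hpos'
  refine ⟨D, hDsymm, hDpos, fun X s t => ?_⟩
  induction s using TensorProduct.induction_on with
  | zero => simp
  | add a b ha hb => simp only [lie_add, map_add, LinearMap.add_apply, ha, hb]
  | tmul v w =>
    induction t using TensorProduct.induction_on with
    | zero => simp
    | add a b ha hb => simp only [lie_add, map_add, ha, hb]
    | tmul v' w' =>
      simp only [TensorProduct.LieModule.lie_tmul_right, map_add, LinearMap.add_apply, hD, hB, hB']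

end Unitarizable

/-! ### The submodule generated by a product of highest weight vectors -/

namespace HermitianSymmetric.CartanData

variable {𝔤 : Type u} [LieRing 𝔤] [LieAlgebra ℝ 𝔤] {S : HermitianSymmetric 𝔤} (C : S.CartanData)

theorem IsDominantIntegral.add {lam mu : C.Weight} (hlam : C.IsDominantIntegral lam)
    (hmu : C.IsDominantIntegral mu) : C.IsDominantIntegral (lam + mu) := by
  intro α hα X hX
  obtain ⟨m, hm⟩ := hlam α hα X hX
  obtain ⟨n, hn⟩ := hmu α hα X hX
  exact ⟨m + n, by rw [LinearMap.add_apply, hm, hn, Nat.cast_add]⟩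

theorem IsHighestWeightVector.tmul {V W : Type*} [AddCommGroup V] [Module ℂ V]
    [LieRingModule (Cplx 𝔤) V] [LieModule ℂ (Cplx 𝔤) V] [AddCommGroup W] [Module ℂ W]
    [LieRingModule (Cplx 𝔤) W] [LieModule ℂ (Cplx 𝔤) W] {lam mu : C.Weight} {v : V} {w : W}
    (hv : C.IsHighestWeightVector lam v) (hw : C.IsHighestWeightVector mu w) :
    C.IsHighestWeightVector (lam + mu) (v ⊗ₜ[ℂ] w) := by
  refine ⟨?_, fun X => ?_, fun α hα x hx => ?_⟩
  · obtain ⟨f, hf⟩ := not_forall.1 (mt (Module.forall_dual_apply_eq_zero_iff ℂ v).1 hv.1)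
    obtain ⟨g, hg⟩ := not_forall.1 (mt (Module.forall_dual_apply_eq_zero_iff ℂ w).1 hw.1)
    intro h
    have h1 := congrArg (TensorProduct.lift ((LinearMap.mul ℂ ℂ).compl₁₂ f g)) h
    rw [map_zero] at h1
    exact mul_ne_zero hf hg h1
  · rw [TensorProduct.LieModule.lie_tmul_right, hv.2.1, hw.2.1, LinearMap.add_apply,
      TensorProduct.tmul_smul, ← TensorProduct.smul_tmul', ← add_smul, Complex.ofReal_add]
  · rw [TensorProduct.LieModule.lie_tmul_right, hv.2.2 α hα x hx, hw.2.2 α hα x hx,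
      TensorProduct.zero_tmul, TensorProduct.tmul_zero, add_zero]

theorem tmul_mem_tensorSubmodule {lam mu : C.Weight} (v : C.L lam) (w : C.L mu) :
    v ⊗ₜ[ℂ] w ∈ C.tensorSubmodule lam mu v w :=
  LieSubmodule.subset_lieSpan rfl

/-- The product of two highest weight vectors, in the submodule that it generates. -/
def tensorVector {lam mu : C.Weight} (v : C.L lam) (w : C.L mu) : C.tensorSubmodule lam mu v w :=
  ⟨v ⊗ₜ[ℂ] w, C.tmul_mem_tensorSubmodule v w⟩

theorem eq_top_of_tensorVector_mem {lam mu : C.Weight} {v : C.L lam} {w : C.L mu}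
    {Q : LieSubmodule ℂ (Cplx 𝔤) (C.tensorSubmodule lam mu v w)}
    (hQ : C.tensorVector v w ∈ Q) : Q = ⊤ := by
  have h : C.tensorSubmodule lam mu v w ≤ Q.map (C.tensorSubmodule lam mu v w).incl :=
    LieSubmodule.lieSpan_le.2 (Set.singleton_subset_iff.2 ((LieSubmodule.mem_map _).2
      ⟨_, hQ, rfl⟩))
  rw [eq_top_iff]
  rintro ⟨x, hx⟩ -
  obtain ⟨y, hy, hyx⟩ := (LieSubmodule.mem_map _).1 (h hx)
  have : y = ⟨x, hx⟩ := Subtype.ext hyx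
  rwa [← this]

/-- The submodule is unitarizable inside the tensor product and generated by v ⊗ w, so
`nonempty_lieEquiv_L` identifies it. -/
theorem nonempty_lieEquiv_tensorSubmodule [FiniteDimensional ℝ 𝔤] [LieAlgebra.IsSimple ℝ 𝔤]
    {lam mu : C.Weight} (hlam : IsUnitarizable (𝔤 := 𝔤) (C.L lam))
    (hmu : IsUnitarizable (𝔤 := 𝔤) (C.L mu)) {v : C.L lam} {w : C.L mu}
    (hv : C.IsHighestWeightVector lam v) (hw : C.IsHighestWeightVector mu w) :
    Nonempty (C.L (lam + mu) ≃ₗ⁅ℂ, Cplx 𝔤⁆ C.tensorSubmodule lam mu v w) := by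
  have h := hv.tmul C hw
  refine C.nonempty_lieEquiv_L (lam + mu)
    ((hlam.tensorProduct hmu).of_injective (C.tensorSubmodule lam mu v w).incl
      Subtype.val_injective) (m := C.tensorVector v w) ?_
    fun Q hQ => C.eq_top_of_tensorVector_mem hQ
  exact ⟨fun h0 => h.1 (congrArg Subtype.val h0), fun X => Subtype.ext (h.2.1 X),
    fun α hα x hx => Subtype.ext (h.2.2 α hα x hx)⟩

/-- Invariance is the Leibniz rule. The restriction is non-zero because it is already so at the
generator, where both factors are non-zero by `sphericalFunctional_apply_ne_zero`. -/
theorem isSphericalFunctional_antilinearTensor [FiniteDimensional ℝ 𝔤] [LieAlgebra.IsSimple ℝ 𝔤]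
    (hS : S.IsCompactlyCausal) {lam mu : C.Weight} {v : C.L lam} {w : C.L mu}
    (hv : C.IsHighestWeightVector lam v) (hw : C.IsHighestWeightVector mu w)
    {ν₁ : C.L lam →ₛₗ[starRingEnd ℂ] ℂ} {ν₂ : C.L mu →ₛₗ[starRingEnd ℂ] ℂ}
    (hν₁ : S.IsSphericalFunctional ν₁) (hν₂ : S.IsSphericalFunctional ν₂) :
    S.IsSphericalFunctional
      ((antilinearTensor ν₁ ν₂).comp (C.tensorSubmodule lam mu v w).toSubmodule.subtype :
        C.tensorSubmodule lam mu v w →ₛₗ[starRingEnd ℂ] ℂ) := by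
  refine ⟨fun h0 => ?_, fun X hX u => ?_⟩
  · have h := LinearMap.congr_fun h0 (C.tensorVector v w)
    change ν₁ v * ν₂ w = 0 at h
    exact mul_ne_zero (C.sphericalFunctional_apply_ne_zero hS hv hν₁)
      (C.sphericalFunctional_apply_ne_zero hS hw hν₂) h
  · have key : ∀ t : C.L lam ⊗[ℂ] C.L mu, antilinearTensor ν₁ ν₂ ⁅toCplx X, t⁆ = 0 := by
      intro t
      induction t using TensorProduct.induction_on with
      | zero => rw [lie_zero, map_zero]
      | tmul a b =>
        rw [TensorProduct.LieModule.lie_tmul_right, map_add, antilinearTensor_tmul,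
          antilinearTensor_tmul, hν₁.2 X hX, hν₂.2 X hX, zero_mul, mul_zero, add_zero]
      | add a b ha hb => rw [lie_add, map_add, ha, hb, add_zero]
    exact key u

theorem isSphericalFunctional_comp_lieEquiv {V W : Type*} [AddCommGroup V] [Module ℂ V]
    [LieRingModule (Cplx 𝔤) V] [AddCommGroup W] [Module ℂ W] [LieRingModule (Cplx 𝔤) W]
    {ν : W →ₛₗ[starRingEnd ℂ] ℂ} (hν : S.IsSphericalFunctional ν) (e : V ≃ₗ⁅ℂ, Cplx 𝔤⁆ W) :
    S.IsSphericalFunctional (ν.comp (e : V →ₗ[ℂ] W)) := by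
  refine ⟨fun h0 => hν.1 (LinearMap.ext fun w => ?_), fun X hX v => ?_⟩
  · have h := LinearMap.congr_fun h0 (e.symm w)
    change ν (e (e.symm w)) = 0 at h
    rw [LieModuleEquiv.apply_symm_apply] at h
    exact h
  · change ν (e ⁅toCplx X, v⁆) = 0
    rw [show e ⁅toCplx X, v⁆ = ⁅toCplx X, e v⁆ from e.toLieModuleHom.map_lie _ _]
    exact hν.2 X hX _

theorem nontrivial_of_isSpherical {V : Type*} [AddCommGroup V] [Module ℂ V]
    [LieRingModule (Cplx 𝔤) V] (hV : S.IsSpherical V) : Nontrivial V := by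
  obtain ⟨ν, hν, -⟩ := hV
  by_contra h
  rw [not_nontrivial_iff_subsingleton] at h
  exact hν (LinearMap.ext fun v => by rw [Subsingleton.elim v 0, map_zero, map_zero])

end HermitianSymmetric.CartanData

end

theorem lemmaV13 {𝔤 : Type*} [LieRing 𝔤] [LieAlgebra ℝ 𝔤] [FiniteDimensional ℝ 𝔤]
    [LieAlgebra.IsSimple ℝ 𝔤] (S : HermitianSymmetric 𝔤) (hS : S.IsCompactlyCausal)
    (C : S.CartanData) (lam mu : C.Weight)
    (hlam : C.IsDominantIntegral lam) (hmu : C.IsDominantIntegral mu)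
    (hlam_unitary : IsUnitarizable (𝔤 := 𝔤) (C.L lam)) (hlam_spherical : S.IsSpherical (C.L lam))
    (hmu_unitary : IsUnitarizable (𝔤 := 𝔤) (C.L mu)) (hmu_spherical : S.IsSpherical (C.L mu)) :
    C.IsDominantIntegral (lam + mu) ∧
    IsUnitarizable (𝔤 := 𝔤) (C.L (lam + mu)) ∧
    S.IsSpherical (C.L (lam + mu)) ∧
    (∃ v : C.L lam, C.IsHighestWeightVector lam v) ∧
    (∃ w : C.L mu, C.IsHighestWeightVector mu w) ∧
    ∀ (v : C.L lam) (w : C.L mu),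
      C.IsHighestWeightVector lam v → C.IsHighestWeightVector mu w →
      Nonempty (C.L (lam + mu) ≃ₗ⁅ℂ, Cplx 𝔤⁆ C.tensorSubmodule lam mu v w) ∧
      ∀ (ν₁ : C.L lam →ₛₗ[starRingEnd ℂ] ℂ) (ν₂ : C.L mu →ₛₗ[starRingEnd ℂ] ℂ),
        S.IsSphericalFunctional ν₁ → S.IsSphericalFunctional ν₂ →
        S.IsSphericalFunctional
          ((antilinearTensor ν₁ ν₂).comp
            (C.tensorSubmodule lam mu v w).toSubmodule.subtype :
            C.tensorSubmodule lam mu v w →ₛₗ[starRingEnd ℂ] ℂ) := by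
  -- The construction of L(λ) does not by itself exclude J(λ) = N(λ); a non-zero functional does,
  -- and this provides highest weight vectors.
  have := HermitianSymmetric.CartanData.nontrivial_of_isSpherical hlam_spherical
  have := HermitianSymmetric.CartanData.nontrivial_of_isSpherical hmu_spherical
  obtain ⟨v, hv⟩ := C.exists_isHighestWeightVector lam
  obtain ⟨w, hw⟩ := C.exists_isHighestWeightVector mu
  obtain ⟨e⟩ := C.nonempty_lieEquiv_tensorSubmodule hlam_unitary hmu_unitary hv hw
  obtain ⟨ν₁, hν₁⟩ := hlam_spherical
  obtain ⟨ν₂, hν₂⟩ := hmu_spherical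
  exact ⟨hlam.add C hmu,
    (hlam_unitary.tensorProduct hmu_unitary).of_injective
      ((C.tensorSubmodule lam mu v w).incl.comp e.toLieModuleHom)
      (Subtype.val_injective.comp e.injective),
    ⟨_, HermitianSymmetric.CartanData.isSphericalFunctional_comp_lieEquiv
      (C.isSphericalFunctional_antilinearTensor hS hv hw hν₁ hν₂) e⟩,
    ⟨v, hv⟩, ⟨w, hw⟩, fun v' w' hv' hw' =>
      ⟨C.nonempty_lieEquiv_tensorSubmodule hlam_unitary hmu_unitary hv' hw',
        fun _ _ h₁ h₂ => C.isSphericalFunctional_antilinearTensor hS hv' hw' h₁ h₂⟩⟩
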